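/- Let $L$ be an infinite field with $\operatorname{char} L\neq 2,3$, let $F=L(\omega)$ where $\omega$ is a primitive cube root of unity (possibly $F=L$), and let $f(X,Y)=aX^3+bY^3$ with $a,b\in L^*$. For $k\in\{L,F\}$ let $A_{f,k}$ be the generalized Clifford algebra of $f$ over $k$, i.e. the $k$-algebra generated by $x,y$ with defining relations $(px+qy)^3=f(p,q)$ for all $p,q\in k$; let $Z_k$ be its center, $q(Z_k)$ the quotient field of $Z_k$, and $B_{f,k}=A_{f,k}\otimes_{Z_k}q(Z_k)$ its ring of central quotients. In $A_{f,F}$ put $$z=yx-\omega xy,\quad \zeta=yx-\omega^2xy,\quad r=z\zeta,\quad s=\tfrac12(z^3+\zeta^3),\quad u=z+\zeta,$$ and let $K=F(r,s)(u)$ be the subfield of $B_{f,F}$ generated over $F$ by $r,s,u$. Let $c=-\tfrac{27}{4}a^2b^2$ and let $E'$ be the elliptic curve $Y^2=X^3-27c$. Call a subfield of a ring $B$ a maximal subfield if no subfield of $B$ properly contains it and it is its own centralizer in $B$. **Proposition 7.3.** $K$ is a maximal subfield of $B_{f,F}$, and $K\cong F(E')$ as $F$-algebras, where $F(E')$ is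 the function field of $E'$ over $F$. Suppose moreover that $\omega\notin L$. Then there is a unique $L$-algebra automorphism $\sigma$ of $B_{f,F}$ with $\sigma(\omega)=\omega^2$, $\sigma(x)=x$, $\sigma(y)=y$, and a unique $L$-algebra homomorphism $B_{f,L}\to B_{f,F}$ with $x\mapsto x$, $y\mapsto y$; the latter is injective and its image is the fixed ring $B_{f,F}^{\sigma}$. With $B_{f,L}$ identified with this image, the fixed field $K^\sigma=\{v\in K:\sigma(v)=v\}$ is a maximal subfield of $B_{f,L}$, and $K^\sigma\cong L(E')$ as $L$-algebras. -/

import Mathlib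

open scoped TensorProduct

noncomputable section

namespace CubicClifford

section Algebra

variable {k : Type*} [Field k] (a b : k)

/-- The defining relations `(p x + q y)³ = f(p, q)`, `p, q ∈ k`, of the generalized Clifford
algebra of the diagonal binary cubic form `f(X, Y) = a X³ + b Y³`; the free generators `0` and `1`
play the roles of `x` and `y`. -/
inductive Rel : FreeAlgebra k (Fin 2) → FreeAlgebra k (Fin 2) → Prop
  | cube (p q : k) :
      Rel ((p • FreeAlgebra.ι k (0 : Fin 2) + q • FreeAlgebra.ι k (1 : Fin 2)) ^ 3)
        (algebraMap k (FreeAlgebra k (Fin 2)) (a * p ^ 3 + b * q ^ 3))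

/-- The generalized Clifford algebra `A_{f,k}` of `f(X, Y) = a X³ + b Y³`. -/
def Cliff : Type _ := RingQuot (Rel a b)

instance : Ring (Cliff a b) := inferInstanceAs (Ring (RingQuot (Rel a b)))

instance {R : Type*} [CommRing R] [Algebra R k] : Algebra R (Cliff a b) :=
  inferInstanceAs (Algebra R (RingQuot (Rel a b)))

instance {R : Type*} [CommRing R] [Algebra R k] : IsScalarTower R k (Cliff a b) :=
  inferInstanceAs (IsScalarTower R k (RingQuot (Rel a b)))

/-- The quotient map from the free algebra onto `A_{f,k}`. -/
def mk : FreeAlgebra k (Fin 2) →ₐ[k] Cliff a b := RingQuot.mkAlgHom k (Rel a b)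

/-- The generator `x` of `A_{f,k}`. -/
def x : Cliff a b := mk a b (FreeAlgebra.ι k 0)

/-- The generator `y` of `A_{f,k}`. -/
def y : Cliff a b := mk a b (FreeAlgebra.ι k 1)

/-- The centre `Z(A_{f,k})`. -/
abbrev Z : Subring (Cliff a b) := Subring.center (Cliff a b)

/-- The ring of central quotients `B_{f,k} = A_{f,k} ⊗_Z q(Z)`, where `q(Z)` is the
ring of fractions of the centre `Z` of `A_{f,k}`. -/
abbrev Quot : Type _ := Cliff a b ⊗[Z a b] FractionRing (Z a b)

/-- The canonical map `A_{f,k} → B_{f,k}`. -/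
def toQuot : Cliff a b →ₐ[k] Quot a b := Algebra.TensorProduct.includeLeft

/-- `z = y x - ω x y`. -/
def z (ω : k) : Cliff a b := y a b * x a b - ω • (x a b * y a b)

/-- `ζ = y x - ω² x y`. -/
def zeta (ω : k) : Cliff a b := y a b * x a b - ω ^ 2 • (x a b * y a b)

/-- `r = z ζ`. -/
def r (ω : k) : Cliff a b := z a b ω * zeta a b ω

/-- `s = (z³ + ζ³) / 2`. -/
def s (ω : k) : Cliff a b := (2 : k)⁻¹ • (z a b ω ^ 3 + zeta a b ω ^ 3)

/-- `u = z + ζ`. -/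
def u (ω : k) : Cliff a b := z a b ω + zeta a b ω

/-- The curve `E' : Y² = X³ + d`, where `d = -27 c` and `c = -27 a² b² / 4`. -/
def E' : WeierstrassCurve.Affine k where
  a₁ := 0
  a₂ := 0
  a₃ := 0
  a₄ := 0
  a₆ := -27 * (-27 * a ^ 2 * b ^ 2 / 4)

end Algebra

section Subfields

/-- The `k`-subalgebra of `B` generated by a set `T` under the ring operations and inversion, that
is, the smallest subalgebra that contains `T` and the inverse of each of its elements that is
invertible in `B`. If some subfield of `B` contains `k` and `T`, then this is the smallest such
subfield, `k(T)`. -/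
def fieldAdjoin (k : Type*) {B : Type*} [Field k] [Ring B] [Algebra k B] (T : Set B) :
    Subalgebra k B :=
  sInf {S | T ⊆ S ∧ ∀ v ∈ S, ∀ w : B, v * w = 1 → w * v = 1 → w ∈ S}

/-- `K` is a maximal subfield of the ring `B`: it is a field, no subfield of `B` contains it
properly, and moreover it is its own centralizer (for a central simple algebra `B` the last
condition says that the degree of `K` over the centre is the degree of `B`). -/
structure IsMaximalSubfield {B : Type*} [Ring B] (K : Subring B) : Prop where
  isField : IsField K
  eq_of_le : ∀ M : Subring B, IsField M → K ≤ M → M = K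
  centralizer_eq : Subring.centralizer (K : Set B) = K

/-- The subalgebra of elements fixed by `σ`. -/
def fixed {L B : Type*} [Field L] [Ring B] [Algebra L B] (σ : B ≃ₐ[L] B) : Subalgebra L B :=
  AlgHom.equalizer (σ : B →ₐ[L] B) (AlgHom.id L B)

end Subfields

section MaximalSubfield

variable {k : Type*} [Field k] (a b : k)

/-- The subfield `K = k(r, s)(u)` of `B_{f,k}`, where `ω ∈ k` is a primitive cube root of unity. -/
def K (ω : k) : Subalgebra k (Quot a b) :=
  fieldAdjoin k {toQuot a b (r a b ω), toQuot a b (s a b ω), toQuot a b (u a b ω)}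

end MaximalSubfield

section Conjugation

variable {L : Type*} (F : Type*) [Field L] [Field F] [Algebra L F] (a b : L)

/-- `B_{f,F}` for a form `f = a X³ + b Y³` over `L` and an extension field `F` of `L`. -/
abbrev QuotExt : Type _ := Quot (algebraMap L F a) (algebraMap L F b)

/-- `σ` is the extension to `B_{f,F}` of the automorphism of `F = L(ω)` that takes `ω` to `ω²`:
it is `L`-linear, takes `ω` to `ω²`, and fixes `x` and `y`. -/
def IsConj (ω : F) (σ : QuotExt F a b ≃ₐ[L] QuotExt F a b) : Prop :=
  σ (algebraMap F _ ω) = algebraMap F _ (ω ^ 2) ∧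
  σ (toQuot _ _ (x _ _)) = toQuot _ _ (x _ _) ∧
  σ (toQuot _ _ (y _ _)) = toQuot _ _ (y _ _)

/-- `ι` is the canonical map `B_{f,L} → B_{f,F}`: it is `L`-linear and takes `x` to `x` and `y`
to `y`. -/
def IsCanonical (ι : Quot a b →ₐ[L] QuotExt F a b) : Prop :=
  ι (toQuot a b (x a b)) = toQuot _ _ (x _ _) ∧
  ι (toQuot a b (y a b)) = toQuot _ _ (y _ _)

end Conjugation

end CubicClifford

end

/-!
The main part works over any field `k` of characteristic not `2` or `3` and needs no cube root of
unity in `k`; so `L` and `F` are two instances of one statement. Put `d = xy` and `e = yx`. The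
defining relations say `x³ = a`, `y³ = b` and that the two mixed terms of the cube vanish
(`mixed_relations`). Hence `d` and `e` commute, `d e (d + e) = -ab`, conjugation by `x` takes
`d ↦ -(d + e)` and `e ↦ d`, and, with `C = k[d, e]`, the Clifford algebra is `A = C + C x + C x²`
(`exists_eq_add`).

The elements `X = 9 e (d + e)` and `Y = 3 e X - 27ab/2` satisfy the equation of `E'`, and
`d X = -9ab`, so `d` and `e` are rational functions of `X` and `Y`: in effect `C` is `k[E']` with
`X` inverted. To prove it, `A` is represented by `3 × 3` matrices over `k(E')`, with `d`, `e`
diagonal and `x` a cyclic shift (`rep`). An element of `C` times a power of `X` is of the form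
`p(X) + q(X) Y`, and `1, Y` are linearly independent over `k[X]`, so the representation is injective
on `C` (`eq_zero_of_rep_apply_eq_zero`), and then, by a look at the first row, on `A`
(`rep_injective`). The diagonal entries of `d` are distinct, which makes `C` its own centralizer.
Central elements become scalars; so the centre is a domain, and the representation extends to an
injective one of the ring of central quotients `B` (`exists_rep_quot`).

Let `K` be the centralizer of `d` and `e` in `B`. Its elements are fractions `c / n` with `c ∈ C`
and `n` central; they are invertible because the product of the three conjugates of `c` under `x` is
central (`exists_norm`). The upper left matrix entry maps the field `K` isomorphically onto `k(E')`,
and `K` is its own centralizer by construction, hence maximal among subfields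
(`isMaximalSubfield_Kxy`, `nonempty_Kxy_algEquiv`). If `ω ∈ k`, then `u = 2e + d` and
`u² - r = 3 e (d + e)`, so that `d` and `e` can be recovered from `r` and `u`, and `K = k(r, s)(u)`
(`K_eq_Kxy`).

For the descent from `F` to `L`, the comparison with `F ⊗_L A_{f,L}` shows
`A_{f,F} = A_{f,L} ⊕ ω A_{f,L}` and provides the conjugation. Both the conjugation and the map
`A_{f,L} → A_{f,F}` extend to central quotients by their universal property
(`CentralQuot.exists_lift`). Multiplying a central denominator by its conjugate puts it into
`A_{f,L}`, so a fixed fraction comes from `B_{f,L}` (`IsCanonical.range_eq_fixed`). Finally `d` and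
`e` are defined over `L`, so `K ∩ B_{f,L}` is the centralizer of `d` and `e` in `B_{f,L}`
(`map_Kxy`), and the result over `k = L` applies to it.
-/

noncomputable section

namespace CubicClifford

/-! ### Rings of central quotients -/

section CentralQuotient

open nonZeroDivisors Subring

variable {A : Type*} [Ring A]

/-- The ring of central quotients `A ⊗_Z q(Z)` of an arbitrary ring `A` with centre `Z`. -/
abbrev CentralQuot (A : Type*) [Ring A] : Type _ := A ⊗[center A] FractionRing (center A)

theorem tmul_algebraMap_central (α : A) (c : center A) :
    (α ⊗ₜ algebraMap (center A) (FractionRing (center A)) c : CentralQuot A) =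
      (α * (c : A)) ⊗ₜ 1 := by
  rw [Algebra.algebraMap_eq_smul_one, ← TensorProduct.smul_tmul]
  congr 1
  rw [Subring.smul_def, smul_eq_mul]
  exact (mem_center_iff.1 c.2 α).symm

/-- Every element of the ring of central quotients is a fraction with central denominator. -/
theorem exists_denominator (v : CentralQuot A) :
    ∃ (α : A) (c : center A), c ∈ (center A)⁰ ∧ v * ((c : A) ⊗ₜ 1) = α ⊗ₜ 1 := by
  induction v using TensorProduct.induction_on with
  | zero => exact ⟨0, 1, one_mem _, by simp⟩
  | tmul α t =>
    obtain ⟨⟨p, q⟩, h⟩ := IsLocalization.surj (center A)⁰ t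
    refine ⟨α * p, q, q.2, ?_⟩
    rw [← one_mul ((q : center A) : A), ← tmul_algebraMap_central,
      Algebra.TensorProduct.tmul_mul_tmul, h, tmul_algebraMap_central, mul_one]
  | add v w hv hw =>
    obtain ⟨α, c, hc, h⟩ := hv
    obtain ⟨β, e, he, h'⟩ := hw
    have hce : (c : A) * e = e * c := mem_center_iff.1 e.2 c
    refine ⟨α * e + β * c, c * e, mul_mem hc he, ?_⟩
    have h1 : (((c * e : center A) : A) ⊗ₜ 1 : CentralQuot A) =
        ((c : A) ⊗ₜ 1) * ((e : A) ⊗ₜ 1) := by simp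
    have h2 : (((c * e : center A) : A) ⊗ₜ 1 : CentralQuot A) =
        ((e : A) ⊗ₜ 1) * ((c : A) ⊗ₜ 1) := by simp [hce]
    rw [add_mul]
    nth_rw 1 [h1]
    rw [h2, ← mul_assoc, h, ← mul_assoc, h']
    simp [TensorProduct.add_tmul]

theorem isUnit_central_tmul_one (c : center A) (hc : c ∈ (center A)⁰) :
    IsUnit ((c : A) ⊗ₜ 1 : CentralQuot A) := by
  have h := IsLocalization.map_units (FractionRing (center A)) (⟨c, hc⟩ : (center A)⁰)
  have := h.map (Algebra.TensorProduct.includeRight :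
    FractionRing (center A) →ₐ[center A] CentralQuot A)
  convert this using 1
  simp only [Algebra.TensorProduct.includeRight_apply]
  rw [tmul_algebraMap_central, one_mul]

theorem central_tmul_one_mem_center (c : center A) :
    ((c : A) ⊗ₜ 1 : CentralQuot A) ∈ center (CentralQuot A) := by
  rw [mem_center_iff]
  intro v
  induction v using TensorProduct.induction_on with
  | zero => simp
  | tmul α t => simp [mem_center_iff.1 c.2 α]
  | add v w hv hw => rw [add_mul, hv, hw, mul_add]

theorem CentralQuot.ringHom_ext {T : Type*} [Ring T] {G H : CentralQuot A →+* T}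
    (h : ∀ α : A, G (α ⊗ₜ 1) = H (α ⊗ₜ 1)) : G = H := by
  refine RingHom.ext fun v => ?_
  obtain ⟨α, c, hc, hv⟩ := exists_denominator v
  have hu := (isUnit_central_tmul_one c hc).map G
  rw [← hu.mul_left_inj, ← map_mul, hv, h, h, ← map_mul, hv]

/-- Universal property of the ring of central quotients, for homomorphisms that take the centre
into the centre. -/
theorem CentralQuot.exists_lift {T : Type*} [Ring T] (g : A →+* T)
    (hz : ∀ c : center A, g c ∈ center T) (hu : ∀ c ∈ (center A)⁰, IsUnit (g c)) :
    ∃ G : CentralQuot A →+* T, ∀ α : A, G (α ⊗ₜ 1) = g α := by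
  let i : center A →+* center T :=
    (g.comp (Subring.subtype _)).codRestrict (center T) hz
  have hi : ∀ c : (center A)⁰, IsUnit (i c) := by
    intro c
    obtain ⟨w, hw⟩ := hu c c.2
    have hwc : (w : T) ∈ Set.center T := by rw [hw]; exact hz c
    refine IsUnit.of_mul_eq_one ⟨(w⁻¹ : Tˣ), Set.units_inv_mem_center hwc⟩ ?_
    ext
    change g c * _ = 1
    rw [← hw]; simp
  let _ : Algebra (center A) T := ((Subring.subtype (center T)).comp i).toAlgebra' (by
    intro c t; exact (mem_center_iff.1 (i c).2 t).symm)
  let g' : A →ₐ[center A] T := { g with commutes' := fun c => rfl }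
  let j : FractionRing (center A) →+* center T := IsLocalization.lift hi
  let j' : FractionRing (center A) →ₐ[center A] T :=
    { (Subring.subtype (center T)).comp j with
      commutes' := fun c => by
        change ((j (algebraMap _ _ c) : center T) : T) = _
        rw [IsLocalization.lift_eq]; rfl }
  have hcomm : ∀ α t, Commute (g' α) (j' t) := fun α t => mem_center_iff.1 (j t).2 _
  refine ⟨(Algebra.TensorProduct.lift g' j' hcomm).toRingHom, fun α => ?_⟩
  change Algebra.TensorProduct.lift g' j' hcomm (α ⊗ₜ 1) = _
  rw [Algebra.TensorProduct.lift_tmul, map_one, mul_one]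
  rfl

end CentralQuotient

/-! ### The relations of the Clifford algebra -/

section Relations

variable {k : Type*} [Field k] (a b : k)

theorem cube_linear (p q : k) :
    (p • x a b + q • y a b) ^ 3 = algebraMap k (Cliff a b) (a * p ^ 3 + b * q ^ 3) := by
  have h := RingQuot.mkAlgHom_rel k (Rel.cube (a := a) (b := b) p q)
  have h' : mk a b _ = mk a b _ := h
  rw [AlgHom.commutes] at h'
  rw [← h']
  simp [x, y]

variable {a b} in
/-- Homomorphisms out of `A_{f,k}`, from a pair that satisfies the defining relations. -/
def Cliff.lift {T : Type*} [Ring T] [Algebra k T] (X Y : T)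
    (h : ∀ p q : k, (p • X + q • Y) ^ 3 = algebraMap k T (a * p ^ 3 + b * q ^ 3)) :
    Cliff a b →ₐ[k] T :=
  RingQuot.liftAlgHom k ⟨FreeAlgebra.lift k ![X, Y], by
    rintro _ _ ⟨p, q⟩
    simpa using h p q⟩

variable {a b} in
theorem Cliff.lift_x {T : Type*} [Ring T] [Algebra k T] (X Y : T)
    (h : ∀ p q : k, (p • X + q • Y) ^ 3 = algebraMap k T (a * p ^ 3 + b * q ^ 3)) :
    Cliff.lift X Y h (x a b) = X := by
  refine (RingQuot.liftAlgHom_mkAlgHom_apply k _ _ _).trans ?_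
  simp

variable {a b} in
theorem Cliff.lift_y {T : Type*} [Ring T] [Algebra k T] (X Y : T)
    (h : ∀ p q : k, (p • X + q • Y) ^ 3 = algebraMap k T (a * p ^ 3 + b * q ^ 3)) :
    Cliff.lift X Y h (y a b) = Y := by
  refine (RingQuot.liftAlgHom_mkAlgHom_apply k _ _ _).trans ?_
  simp

theorem adjoin_x_y : Algebra.adjoin k {x a b, y a b} = ⊤ := by
  have h := congrArg (Subalgebra.map (mk a b)) (FreeAlgebra.adjoin_range_ι (R := k) (X := Fin 2))
  rw [AlgHom.map_adjoin, Algebra.map_top] at h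
  have hr : (mk a b).range = ⊤ :=
    (AlgHom.range_eq_top _).2 (RingQuot.mkAlgHom_surjective k (Rel a b))
  rw [hr, ← Set.range_comp] at h
  rw [← h]
  congr 1
  ext v
  simp only [Set.mem_insert_iff, Set.mem_singleton_iff, Set.mem_range, Fin.exists_fin_two, x, y,
    Function.comp_apply, eq_comm]

variable {a b} in
theorem Cliff.algHom_ext {T : Type*} [Ring T] [Algebra k T]
    {G H : Cliff a b →ₐ[k] T} (hx : G (x a b) = H (x a b)) (hy : G (y a b) = H (y a b)) :
    G = H :=
  AlgHom.ext_of_adjoin_eq_top (adjoin_x_y a b) (by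
    rintro _ (rfl | rfl)
    exacts [hx, hy])

theorem x_cube : x a b ^ 3 = algebraMap k (Cliff a b) a := by
  simpa using cube_linear a b 1 0

theorem y_cube : y a b ^ 3 = algebraMap k (Cliff a b) b := by
  simpa using cube_linear a b 0 1

/-- Comparing the relations for `(p, q) = (1, 1)` and `(1, -1)` separates the mixed terms. -/
theorem mixed_relations (h2 : (2 : k) ≠ 0) :
    x a b * x a b * y a b + x a b * y a b * x a b + y a b * x a b * x a b = 0 ∧
    x a b * y a b * y a b + y a b * x a b * y a b + y a b * y a b * x a b = 0 := by
  have h₁ := cube_linear a b 1 1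
  have h₂ := cube_linear a b 1 (-1)
  have hx := x_cube a b
  have hy := y_cube a b
  simp only [one_smul, neg_smul, one_pow, mul_one, map_add, map_mul, map_pow, map_neg, map_one]
    at h₁ h₂
  set X := x a b
  set Y := y a b
  rw [← hx, ← hy] at h₁ h₂
  have two_cancel : ∀ v : Cliff a b, v + v = 0 → v = 0 := by
    intro v hv
    have : (2 : k) • v = 0 := by rw [two_smul, hv]
    exact (smul_eq_zero_iff_right h2).1 this
  constructor
  · apply two_cancel
    linear_combination (norm := noncomm_ring) h₁ - h₂
  · apply two_cancel
    linear_combination (norm := noncomm_ring) h₁ + h₂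

theorem Cliff.induction_left {P : Cliff a b → Prop} (add : ∀ u v, P u → P v → P (u + v))
    (one : P 1) (smul : ∀ (t : k) v, P v → P (t • v))
    (mul_x : ∀ v, P v → P (x a b * v)) (mul_y : ∀ v, P v → P (y a b * v)) (v : Cliff a b) :
    P v := by
  suffices h : ∀ w, P w → P (v * w) by simpa using h 1 one
  have hv : v ∈ Algebra.adjoin k {x a b, y a b} := by rw [adjoin_x_y]; trivial
  induction hv using Algebra.adjoin_induction with
  | mem u hu =>
    rcases hu with rfl | rfl
    exacts [mul_x, mul_y]
  | algebraMap t => intro w hw; rw [← Algebra.smul_def]; exact smul t w hw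
  | add u v _ _ hu hv => intro w hw; rw [add_mul]; exact add _ _ (hu w hw) (hv w hw)
  | mul u v _ _ hu hv => intro w hw; rw [mul_assoc]; exact hu _ (hv w hw)

end Relations

/-! ### The commutative subalgebra generated by `xy` and `yx` -/

section Commutative

variable {k : Type*} [Field k] (a b : k)

/-- The subalgebra `C = k[xy, yx]` of `A_{f,k}`. -/
def Cxy : Subalgebra k (Cliff a b) := Algebra.adjoin k {x a b * y a b, y a b * x a b}

theorem xy_mem_Cxy : x a b * y a b ∈ Cxy a b := Algebra.subset_adjoin (by simp)

theorem yx_mem_Cxy : y a b * x a b ∈ Cxy a b := Algebra.subset_adjoin (by simp)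

theorem mem_center_of_commute {v : Cliff a b} (hx : Commute (x a b) v) (hy : Commute (y a b) v) :
    v ∈ Subring.center (Cliff a b) := by
  rw [Subring.mem_center_iff]
  intro w
  have hw : w ∈ Algebra.adjoin k {x a b, y a b} := by rw [adjoin_x_y]; trivial
  refine (Algebra.commute_of_mem_adjoin_of_forall_mem_commute hw ?_).symm.eq
  rintro _ (rfl | rfl)
  exacts [hx.symm, hy.symm]

theorem yx_mul_x_sq : y a b * x a b * x a b ^ 2 = a • y a b := by
  rw [mul_assoc, ← pow_succ', x_cube, Algebra.smul_def, Algebra.commutes]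

section

variable (h2 : (2 : k) ≠ 0)
include h2

theorem commute_xy_yx : Commute (x a b * y a b) (y a b * x a b) := by
  obtain ⟨s₁, s₂⟩ := mixed_relations a b h2
  rw [commute_iff_eq]
  linear_combination (norm := noncomm_ring) s₂ * x a b - y a b * s₁

/-- The equation `d e (d + e) = -ab` of the curve with coordinates `d = xy` and `e = yx`. -/
theorem xy_mul_yx_mul_add : x a b * y a b * (y a b * x a b * (x a b * y a b + y a b * x a b)) =
    algebraMap k _ (-(a * b)) := by
  obtain ⟨s₁, -⟩ := mixed_relations a b h2
  have h : y a b * x a b * (x a b * y a b + y a b * x a b) = -(y a b ^ 2 * x a b ^ 2) := by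
    linear_combination (norm := noncomm_ring) y a b * s₁
  rw [h, mul_neg, show x a b * y a b * (y a b ^ 2 * x a b ^ 2) = x a b * y a b ^ 3 * x a b ^ 2 by
    noncomm_ring, y_cube, ← Algebra.commutes, mul_assoc, ← pow_succ', x_cube, ← map_mul, ← map_neg,
    mul_comm a]

theorem x_mul_xy : x a b * (x a b * y a b) = -(x a b * y a b + y a b * x a b) * x a b := by
  obtain ⟨s₁, -⟩ := mixed_relations a b h2
  linear_combination (norm := noncomm_ring) s₁

theorem Cxy_commute {c e : Cliff a b} (hc : c ∈ Cxy a b) (he : e ∈ Cxy a b) : Commute c e := by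
  have h := commute_xy_yx a b h2
  refine Algebra.commute_of_mem_adjoin_of_forall_mem_commute he fun w hw => ?_
  refine (Algebra.commute_of_mem_adjoin_of_forall_mem_commute hc fun u hu => ?_).symm
  rcases hu with rfl | rfl <;> rcases hw with rfl | rfl
  exacts [.refl _, h.symm, h, .refl _]

/-- Conjugation by `x` preserves `C`: it takes `xy` to `-(xy + yx)` and `yx` to `xy`. -/
theorem exists_x_mul {c : Cliff a b} (hc : c ∈ Cxy a b) :
    ∃ c' ∈ Cxy a b, x a b * c = c' * x a b := by
  induction hc using Algebra.adjoin_induction with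
  | mem u hu =>
    rcases hu with rfl | rfl
    · exact ⟨_, neg_mem (add_mem (xy_mem_Cxy a b) (yx_mem_Cxy a b)), x_mul_xy a b h2⟩
    · exact ⟨_, xy_mem_Cxy a b, (mul_assoc _ _ _).symm⟩
  | algebraMap t => exact ⟨_, Subalgebra.algebraMap_mem _ t, (Algebra.commutes _ _).symm⟩
  | add u v _ _ hu hv =>
    obtain ⟨u', hu', h⟩ := hu
    obtain ⟨v', hv', h'⟩ := hv
    exact ⟨u' + v', add_mem hu' hv', by rw [mul_add, h, h', add_mul]⟩
  | mul u v _ _ hu hv =>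
    obtain ⟨u', hu', h⟩ := hu
    obtain ⟨v', hv', h'⟩ := hv
    exact ⟨u' * v', mul_mem hu' hv', by rw [← mul_assoc, h, mul_assoc, h', mul_assoc]⟩

/-- `A_{f,k} = C + C x + C x²`. -/
theorem exists_eq_add (ha : a ≠ 0) (v : Cliff a b) :
    ∃ c₀ ∈ Cxy a b, ∃ c₁ ∈ Cxy a b, ∃ c₂ ∈ Cxy a b, v = c₀ + c₁ * x a b + c₂ * x a b ^ 2 := by
  have hx : ∀ v, (∃ c₀ ∈ Cxy a b, ∃ c₁ ∈ Cxy a b, ∃ c₂ ∈ Cxy a b,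
      v = c₀ + c₁ * x a b + c₂ * x a b ^ 2) → ∃ c₀ ∈ Cxy a b, ∃ c₁ ∈ Cxy a b, ∃ c₂ ∈ Cxy a b,
      x a b * v = c₀ + c₁ * x a b + c₂ * x a b ^ 2 := by
    rintro _ ⟨c₀, h₀, c₁, h₁, c₂, h₂, rfl⟩
    obtain ⟨e₀, h₀', k₀⟩ := exists_x_mul a b h2 h₀
    obtain ⟨e₁, h₁', k₁⟩ := exists_x_mul a b h2 h₁
    obtain ⟨e₂, h₂', k₂⟩ := exists_x_mul a b h2 h₂
    refine ⟨e₂ * algebraMap k _ a, mul_mem h₂' (Subalgebra.algebraMap_mem _ a), e₀, h₀', e₁, h₁',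
      ?_⟩
    rw [← x_cube]
    linear_combination (norm := noncomm_ring) k₀ + k₁ * x a b + k₂ * x a b ^ 2
  have hC : ∀ e ∈ Cxy a b, ∀ v, (∃ c₀ ∈ Cxy a b, ∃ c₁ ∈ Cxy a b, ∃ c₂ ∈ Cxy a b,
      v = c₀ + c₁ * x a b + c₂ * x a b ^ 2) → ∃ c₀ ∈ Cxy a b, ∃ c₁ ∈ Cxy a b, ∃ c₂ ∈ Cxy a b,
      e * v = c₀ + c₁ * x a b + c₂ * x a b ^ 2 := by
    rintro e he _ ⟨c₀, h₀, c₁, h₁, c₂, h₂, rfl⟩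
    exact ⟨_, mul_mem he h₀, _, mul_mem he h₁, _, mul_mem he h₂, by noncomm_ring⟩
  induction v using Cliff.induction_left with
  | add u v hu hv =>
    obtain ⟨c₀, h₀, c₁, h₁, c₂, h₂, rfl⟩ := hu
    obtain ⟨e₀, k₀, e₁, k₁, e₂, k₂, rfl⟩ := hv
    exact ⟨_, add_mem h₀ k₀, _, add_mem h₁ k₁, _, add_mem h₂ k₂, by noncomm_ring⟩
  | one => exact ⟨1, one_mem _, 0, zero_mem _, 0, zero_mem _, by simp⟩
  | smul t v hv =>
    rw [Algebra.smul_def]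
    exact hC _ (Subalgebra.algebraMap_mem _ t) v hv
  | mul_x v hv => exact hx v hv
  | mul_y v hv =>
    -- `y = a⁻¹ (yx) x²`
    have h : y a b * v = (a⁻¹ • (y a b * x a b)) * (x a b * (x a b * v)) := by
      rw [← mul_assoc (x a b), ← sq, ← mul_assoc, smul_mul_assoc, yx_mul_x_sq, smul_smul,
        inv_mul_cancel₀ ha, one_smul]
    rw [h]
    exact hC _ (Subalgebra.smul_mem _ (yx_mem_Cxy a b) _) _ (hx _ (hx _ hv))

/-- The product of the conjugates of `c ∈ C` by the powers of `x` is central. -/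
theorem exists_norm (ha : a ≠ 0) {c : Cliff a b} (hc : c ∈ Cxy a b) (hc0 : c ≠ 0) :
    ∃ c' ∈ Cxy a b, ∃ c'' ∈ Cxy a b, c' ≠ 0 ∧ c'' ≠ 0 ∧
      c * (c' * c'') ∈ Subring.center (Cliff a b) := by
  have hxu : IsUnit (x a b) := by
    have h : IsUnit (x a b ^ 3) := by rw [x_cube]; exact ha.isUnit.map _
    exact (isUnit_pow_iff three_ne_zero).1 h
  obtain ⟨c', h', k'⟩ := exists_x_mul a b h2 hc
  obtain ⟨c'', h'', k''⟩ := exists_x_mul a b h2 h'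
  obtain ⟨c₃, h₃, k₃⟩ := exists_x_mul a b h2 h''
  have hc₃ : c₃ = c := by
    have hcen : x a b ^ 3 * c = c * x a b ^ 3 := by rw [x_cube]; exact Algebra.commutes _ _
    have h : c₃ * x a b ^ 3 = c * x a b ^ 3 := by
      rw [← hcen]
      linear_combination (norm := noncomm_ring) (-1 : ℤ) • (k₃ * x a b ^ 2) - x a b * k'' * x a b
        - x a b ^ 2 * k'
    exact (hxu.pow 3).mul_left_injective h
  subst hc₃
  refine ⟨c', h', c'', h'', ?_, ?_, ?_⟩
  · rintro rfl
    exact hc0 ((hxu.mul_right_eq_zero).1 (by rw [k', zero_mul]))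
  · rintro rfl
    exact hc0 ((hxu.mul_left_eq_zero).1 (by rw [← k₃, mul_zero]))
  · have hN : c₃ * (c' * c'') ∈ Cxy a b := mul_mem hc (mul_mem h' h'')
    have hxN : Commute (x a b) (c₃ * (c' * c'')) := by
      rw [commute_iff_eq]
      have e₁ : c' * (c'' * c₃) = c₃ * (c' * c'') := by
        rw [← mul_assoc, (Cxy_commute a b h2 (mul_mem h' h'') hc).eq]
      rw [← e₁]
      linear_combination (norm := noncomm_ring) (x a b * e₁) + k' * (c' * c'') + c' * k'' * c''
        + c' * c'' * k₃
    refine mem_center_of_commute a b hxN ?_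
    have hy : y a b = a⁻¹ • (y a b * x a b * x a b ^ 2) := by
      rw [yx_mul_x_sq, smul_smul, inv_mul_cancel₀ ha, one_smul]
    rw [hy]
    exact ((Cxy_commute a b h2 (yx_mem_Cxy a b) hN).mul_left (hxN.pow_left 2)).smul_left _

end

end Commutative

/-! ### The function field of `E'` -/

section Curve

open Polynomial WeierstrassCurve.Affine

variable {k : Type*} [Field k] (a b : k)

/-- The function field `k(E')`. -/
abbrev FF : Type _ := (E' a b).FunctionField

/-- The coordinate function `X` on `E'`. -/
def XX : FF a b := algebraMap (E' a b).CoordinateRing _ (CoordinateRing.mk (E' a b) (.C .X))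

/-- The coordinate function `Y` on `E'`. -/
def YY : FF a b := algebraMap (E' a b).CoordinateRing _ (CoordinateRing.mk (E' a b) .X)

theorem aeval_XX (p : k[X]) : aeval (XX a b) p =
    algebraMap (E' a b).CoordinateRing (FF a b) (p • 1) := by
  rw [← Algebra.algebraMap_eq_smul_one]
  have h : aeval (XX a b) = ((Algebra.algHom k (E' a b).CoordinateRing (FF a b)).comp
      (Algebra.algHom k k[X] (E' a b).CoordinateRing)) := by
    ext
    simp [XX]
    rfl
  rw [h]; rfl

theorem algebraMap_smul_basis (p q : k[X]) :
    algebraMap (E' a b).CoordinateRing (FF a b)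
      (p • 1 + q • CoordinateRing.mk (E' a b) .X) =
    aeval (XX a b) p + aeval (XX a b) q * YY a b := by
  rw [map_add, aeval_XX, aeval_XX, YY, ← map_mul, smul_mul_assoc, one_mul]

/-- `X` is transcendental and `Y` is not a rational function of `X`. -/
theorem eq_zero_of_aeval_add {p q : k[X]}
    (h : aeval (XX a b) p + aeval (XX a b) q * YY a b = 0) : p = 0 ∧ q = 0 := by
  rw [← algebraMap_smul_basis] at h
  exact CoordinateRing.smul_basis_eq_zero
    ((IsFractionRing.injective (E' a b).CoordinateRing (FF a b)) (h.trans (map_zero _).symm))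

theorem XX_ne_zero : XX a b ≠ 0 := fun h => by
  have := (eq_zero_of_aeval_add a b (p := X) (q := 0) (by simp [h])).1
  exact X_ne_zero this

theorem YY_ne (t : k) : YY a b ≠ algebraMap k _ t := fun h => by
  have := (eq_zero_of_aeval_add a b (p := Polynomial.C (-t)) (q := 1) (by simp [h])).2
  exact one_ne_zero this

theorem YY_sq (h2 : (2 : k) ≠ 0) :
    YY a b ^ 2 = XX a b ^ 3 + (27 * algebraMap k _ (a * b / 2)) ^ 2 := by
  have h := CoordinateRing.smul_basis_mul_Y (W' := E' a b) 0 1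
  have h' := congrArg (algebraMap _ (FF a b)) h
  rw [map_mul, algebraMap_smul_basis, algebraMap_smul_basis] at h'
  have hE : (E' a b).a₆ = (27 * (a * b / 2)) ^ 2 := by
    have h4 : (4 : k) ≠ 0 := by
      rw [show (4 : k) = 2 * 2 by norm_num]; exact mul_ne_zero h2 h2
    simp only [E']
    field_simp
    norm_num
  simp only [hE] at h'
  simp [E'] at h'
  change YY a b * YY a b = _ at h'
  rw [sq, h']
  simp only [map_mul, map_div₀, add_right_inj]
  congr 2
  exact map_ofNat (algebraMap k (FF a b)) 27

/-- `k(E')` is generated by `X` and `Y` under the ring operations and inversion. -/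
theorem subalgebra_eq_top {T : Subalgebra k (FF a b)} (hX : XX a b ∈ T) (hY : YY a b ∈ T)
    (hinv : ∀ v ∈ T, v⁻¹ ∈ T) : T = ⊤ := by
  have hS : ∀ s, algebraMap (E' a b).CoordinateRing (FF a b) s ∈ T := by
    intro s
    obtain ⟨p, q, rfl⟩ := CoordinateRing.exists_smul_basis_eq s
    rw [algebraMap_smul_basis]
    have h : ∀ p : k[X], aeval (XX a b) p ∈ T := fun p =>
      Algebra.adjoin_le (Set.singleton_subset_iff.2 hX) (aeval_mem_adjoin_singleton k _)
    exact add_mem (h p) (mul_mem (h q) hY)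
  rw [eq_top_iff]
  rintro v -
  obtain ⟨s, t, -, rfl⟩ := IsFractionRing.div_surjective (A := (E' a b).CoordinateRing) v
  rw [div_eq_mul_inv]
  exact mul_mem (hS s) (hinv _ (hS _))

end Curve

section Evaluation

open Polynomial

variable {k : Type*} [Field k] {a b : k}

/-- In a commutative algebra with `d e (d + e) = -ab`, the elements `X = 9 e (d + e)` and
`Y = 3 e X - 27ab/2` satisfy the equation of `E'`, and `d X` and `e X` are polynomials in `X` and
`Y`; so a power of `X` takes an element of `k[d, e]` to the form `p(X) + q(X) Y`. -/
theorem exists_aeval_of_mem_adjoin (h2 : (2 : k) ≠ 0) (h3 : (3 : k) ≠ 0)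
    {R : Type*} [CommRing R] [Algebra k R] {d e X Y : R}
    (hde : d * (e * (d + e)) = algebraMap k R (-(a * b))) (hX : X = 9 * (e * (d + e)))
    (hY : Y = 3 * (e * X) - 27 * algebraMap k R (a * b / 2)) {c : R}
    (hc : c ∈ Algebra.adjoin k {d, e}) :
    ∃ (n : ℕ) (p q : k[X]), X ^ n * c = aeval X p + aeval X q * Y := by
  have hab : algebraMap k R (-(a * b)) = -(2 * algebraMap k R (a * b / 2)) := by
    rw [← map_ofNat (algebraMap k R), ← map_mul, ← map_neg, mul_div_cancel₀ _ h2]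
  have i3 : algebraMap k R 3⁻¹ * 3 = 1 := by
    rw [← map_ofNat (algebraMap k R), ← map_mul, inv_mul_cancel₀ h3, map_one]
  rw [hab] at hde
  have hY2 : Y ^ 2 = X ^ 3 + (27 * algebraMap k R (a * b / 2)) ^ 2 := by
    rw [hY]
    linear_combination -81 * e * X * hde - (9 * e * d * X + X ^ 2) * hX
  induction hc using Algebra.adjoin_induction with
  | mem u hu =>
    rcases hu with rfl | rfl
    · refine ⟨1, Polynomial.C (-(18 * (a * b / 2))), 0, ?_⟩
      simp only [map_zero, zero_mul, add_zero, aeval_C, map_neg, map_mul, map_ofNat]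
      linear_combination u * hX + 9 * hde
    · refine ⟨1, Polynomial.C (9 * (a * b / 2)), Polynomial.C 3⁻¹, ?_⟩
      simp only [aeval_C, map_mul, map_ofNat]
      linear_combination -(u * X - 9 * algebraMap k R (a * b / 2)) * i3 - algebraMap k R 3⁻¹ * hY
  | algebraMap t => exact ⟨0, Polynomial.C t, 0, by simp⟩
  | add u v _ _ hu hv =>
    obtain ⟨n, p, q, h⟩ := hu
    obtain ⟨m, p', q', h'⟩ := hv
    refine ⟨n + m, .X ^ m * p + .X ^ n * p', .X ^ m * q + .X ^ n * q', ?_⟩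
    simp
    linear_combination X ^ m * h + X ^ n * h'
  | mul u v _ _ hu hv =>
    obtain ⟨n, p, q, h⟩ := hu
    obtain ⟨m, p', q', h'⟩ := hv
    refine ⟨n + m, p * p' + q * q' * (.X ^ 3 + .C ((27 * (a * b / 2)) ^ 2)), p * q' + q * p', ?_⟩
    simp only [map_add, map_mul, aeval_X, aeval_C, map_pow, map_ofNat] at hY2 ⊢
    linear_combination (X ^ m * v) * h + (aeval X p + aeval X q * Y) * h' +
      aeval X q * aeval X q' * hY2

end Evaluation

/-! ### The matrix representation over the function field -/

section Representation

open Matrix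

/-- The hypothesis is that the sum of the principal minors of size two vanishes, so that the
characteristic polynomial of this traceless matrix has no middle terms. -/
theorem cyclic_matrix_cube {R : Type*} [CommRing R] (p e₁ e₂ e₃ α : R)
    (h : p * (e₁ + e₂ + α * e₃) = 0) :
    !![0, p, e₃; e₁, 0, p; p * α, e₂, 0] ^ 3 =
      algebraMap R (Matrix (Fin 3) (Fin 3) R) (α * p ^ 3 + e₁ * e₂ * e₃) := by
  ext i j
  fin_cases i <;> fin_cases j <;>
    simp [pow_succ, Matrix.mul_apply, Fin.sum_univ_three, Matrix.algebraMap_matrix_apply]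
  · ring
  · linear_combination p * h
  · linear_combination e₃ * h
  · linear_combination e₁ * h
  · ring
  · linear_combination p * h
  · linear_combination p * α * h
  · linear_combination e₂ * h
  · ring

/-- A matrix that commutes with a diagonal matrix with distinct entries is diagonal. -/
theorem eq_diagonal_of_commute {n R : Type*} [Fintype n] [DecidableEq n] [Field R]
    {D : n → R} (hD : Function.Injective D) {N : Matrix n n R} (h : Commute N (diagonal D)) :
    N = diagonal N.diag := by
  ext i j
  by_cases hij : i = j
  · subst hij; simp
  · rw [diagonal_apply_ne _ hij]
    have h' := congrFun (congrFun h.eq i) j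
    rw [mul_diagonal, diagonal_mul, mul_comm, ← sub_eq_zero, ← sub_mul] at h'
    exact (mul_eq_zero.1 h').resolve_left (sub_ne_zero.2 fun e => hij (hD e).symm)

variable {k : Type*} [Field k] (a b : k)

/-- The values of `xy` and its conjugates under `x`, as functions on `E'`. They have sum `0` and
product `ab`; the value of `yx` is the last one. -/
def dd : Fin 3 → FF a b :=
  ![-18 * algebraMap k _ (a * b / 2) / XX a b,
    (27 * algebraMap k _ (a * b / 2) - YY a b) / (3 * XX a b),
    (YY a b + 27 * algebraMap k _ (a * b / 2)) / (3 * XX a b)]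

section

variable (h2 : (2 : k) ≠ 0) (h3 : (3 : k) ≠ 0)

include h3 in
theorem three_FF : (3 : FF a b) ≠ 0 := by
  rw [← map_ofNat (algebraMap k (FF a b)) 3]
  exact (map_ne_zero _).2 h3

include h2 in
theorem two_FF : (2 : FF a b) ≠ 0 := by
  rw [← map_ofNat (algebraMap k (FF a b)) 2]
  exact (map_ne_zero _).2 h2

include h3 in
theorem dd_sum : dd a b 0 + dd a b 1 + dd a b 2 = 0 := by
  have := XX_ne_zero a b
  have := three_FF a b h3
  simp only [dd, Matrix.cons_val]
  field_simp
  ring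

include h2 h3 in
theorem dd_prod : dd a b 0 * dd a b 1 * dd a b 2 = algebraMap k _ (a * b) := by
  have := XX_ne_zero a b
  have := three_FF a b h3
  have hY := YY_sq a b h2
  have hab : algebraMap k (FF a b) (a * b) = 2 * algebraMap k _ (a * b / 2) := by
    rw [← map_ofNat (algebraMap k (FF a b)) 2, ← map_mul, mul_div_cancel₀ _ h2]
  rw [hab]
  simp only [dd, Matrix.cons_val]
  field_simp
  linear_combination 18 * algebraMap k _ (a * b / 2) * hY

include h2 h3 in
theorem nine_mul_dd : 9 * (dd a b 2 * (dd a b 0 + dd a b 2)) = XX a b := by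
  have := XX_ne_zero a b
  have := three_FF a b h3
  have hY := YY_sq a b h2
  simp only [dd, Matrix.cons_val]
  field_simp
  linear_combination 9 * hY

include h3 in
theorem three_mul_dd :
    3 * (dd a b 2 * XX a b) - 27 * algebraMap k _ (a * b / 2) = YY a b := by
  have := XX_ne_zero a b
  have := three_FF a b h3
  simp only [dd, Matrix.cons_val]
  field_simp
  ring

include h2 h3 in
theorem dd_injective : Function.Injective (dd a b) := by
  have hX := XX_ne_zero a b
  have hF3 := three_FF a b h3
  have hF2 := two_FF a b h2
  have hY : ∀ n : k, YY a b - algebraMap k _ n ≠ 0 := fun n => sub_ne_zero.2 (YY_ne a b _)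
  have h01 : dd a b 0 - dd a b 1 ≠ 0 := by
    have h : dd a b 0 - dd a b 1 = (YY a b - algebraMap k _ (81 * (a * b / 2))) / (3 * XX a b) := by
      rw [map_mul, map_ofNat]
      simp only [dd, Matrix.cons_val]
      field_simp
      ring
    rw [h]
    exact div_ne_zero (hY _) (mul_ne_zero hF3 hX)
  have h02 : dd a b 0 - dd a b 2 ≠ 0 := by
    have h : dd a b 0 - dd a b 2 =
        -(YY a b - algebraMap k _ (-(81 * (a * b / 2)))) / (3 * XX a b) := by
      rw [map_neg, map_mul, map_ofNat]
      simp only [dd, Matrix.cons_val]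
      field_simp
      ring
    rw [h]
    exact div_ne_zero (neg_ne_zero.2 (hY _)) (mul_ne_zero hF3 hX)
  have h12 : dd a b 1 - dd a b 2 ≠ 0 := by
    have h : dd a b 1 - dd a b 2 =
        -(2 * (YY a b - algebraMap k _ 0)) / (3 * XX a b) := by
      rw [map_zero]
      simp only [dd, Matrix.cons_val]
      field_simp
      ring
    rw [h]
    exact div_ne_zero (neg_ne_zero.2 (mul_ne_zero hF2 (hY _))) (mul_ne_zero hF3 hX)
  rw [sub_ne_zero] at h01 h02 h12
  intro i j h
  fin_cases i <;> fin_cases j <;> simp_all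

variable (ha : a ≠ 0)

include h2 h3 ha in
theorem rep_relation (p q : k) :
    (p • !![0, 1, 0; 0, 0, 1; algebraMap k (FF a b) a, 0, 0] +
      q • !![0, 0, (algebraMap k _ a)⁻¹ * dd a b 2; dd a b 0, 0, 0; 0, dd a b 1, 0]) ^ 3 =
      algebraMap k (Matrix (Fin 3) (Fin 3) (FF a b)) (a * p ^ 3 + b * q ^ 3) := by
  have hA : algebraMap k (FF a b) a ≠ 0 := (map_ne_zero _).2 ha
  have h := cyclic_matrix_cube (algebraMap k (FF a b) p) (algebraMap k _ q * dd a b 0)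
    (algebraMap k _ q * dd a b 1) (algebraMap k _ q * ((algebraMap k _ a)⁻¹ * dd a b 2))
    (algebraMap k _ a) (by
      have := dd_sum a b h3
      field_simp
      linear_combination algebraMap k (FF a b) p * algebraMap k (FF a b) q * this)
  rw [IsScalarTower.algebraMap_apply k (FF a b) (Matrix (Fin 3) (Fin 3) (FF a b))]
  convert h using 2
  · rw [← algebraMap_smul (FF a b) p, ← algebraMap_smul (FF a b) q]
    ext i j
    fin_cases i <;> fin_cases j <;> simp <;> simp [Algebra.smul_def]
  · have := dd_prod a b h2 h3
    simp only [map_add, map_mul, map_pow] at this ⊢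
    field_simp
    linear_combination -(algebraMap k (FF a b) q) ^ 3 * this

/-- The representation of `A_{f,k}` by matrices over `k(E')`, in which `xy` and `yx` are diagonal
and `x` is a cyclic shift. -/
def rep : Cliff a b →ₐ[k] Matrix (Fin 3) (Fin 3) (FF a b) :=
  Cliff.lift _ _ (rep_relation a b h2 h3 ha)

include h2 h3 ha

theorem rep_x : rep a b h2 h3 ha (x a b) = !![0, 1, 0; 0, 0, 1; algebraMap k _ a, 0, 0] :=
  Cliff.lift_x _ _ _

theorem rep_y : rep a b h2 h3 ha (y a b) =
    !![0, 0, (algebraMap k _ a)⁻¹ * dd a b 2; dd a b 0, 0, 0; 0, dd a b 1, 0] :=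
  Cliff.lift_y _ _ _

theorem rep_xy : rep a b h2 h3 ha (x a b * y a b) = diagonal (dd a b) := by
  have hA : algebraMap k (FF a b) a ≠ 0 := (map_ne_zero _).2 ha
  rw [map_mul, rep_x, rep_y]
  ext i j
  fin_cases i <;> fin_cases j <;>
    simp [Matrix.mul_apply, Fin.sum_univ_three, hA]

theorem rep_yx : rep a b h2 h3 ha (y a b * x a b) = diagonal ![dd a b 2, dd a b 0, dd a b 1] := by
  have hA : algebraMap k (FF a b) a ≠ 0 := (map_ne_zero _).2 ha
  rw [map_mul, rep_x, rep_y]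
  ext i j
  fin_cases i <;> fin_cases j <;>
    simp [Matrix.mul_apply, Fin.sum_univ_three, mul_right_comm _ (dd a b 2), hA]

theorem rep_eq_diagonal {c : Cliff a b} (hc : c ∈ Cxy a b) :
    rep a b h2 h3 ha c = diagonal (rep a b h2 h3 ha c).diag := by
  have h : Cxy a b ≤
      (diagonalAlgHom k (n := Fin 3) (α := FF a b)).range.comap (rep a b h2 h3 ha) := by
    refine Algebra.adjoin_le ?_
    rintro _ (rfl | rfl)
    · exact ⟨_, (rep_xy a b h2 h3 ha).symm⟩
    · exact ⟨_, (rep_yx a b h2 h3 ha).symm⟩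
  obtain ⟨D, hD⟩ := h hc
  have hD' : diagonal D = rep a b h2 h3 ha c := hD
  rw [← hD', diag_diagonal]

/-- The evaluation of `C = k[xy, yx]` at the generic point of `E'` is injective. -/
theorem eq_zero_of_rep_apply_eq_zero {c : Cliff a b} (hc : c ∈ Cxy a b) (hb : b ≠ 0)
    (h0 : rep a b h2 h3 ha c 0 0 = 0) : c = 0 := by
  let _ : CommRing (Cxy a b) :=
    { (inferInstance : Ring (Cxy a b)) with
      mul_comm := fun c e => Subtype.ext (Cxy_commute a b h2 c.2 e.2).eq }
  let d : Cxy a b := ⟨_, xy_mem_Cxy a b⟩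
  let e : Cxy a b := ⟨_, yx_mem_Cxy a b⟩
  have hgen : (⟨c, hc⟩ : Cxy a b) ∈ Algebra.adjoin k {d, e} := by
    have htop := Algebra.adjoin_adjoin_coe_preimage (R := k) (s := {x a b * y a b, y a b * x a b})
    have hmem : (⟨c, hc⟩ : Cxy a b) ∈ (⊤ : Subalgebra k (Cxy a b)) := trivial
    refine Algebra.adjoin_mono ?_ (htop.ge hmem)
    rintro v (hv | hv)
    exacts [Or.inl (Subtype.ext hv), Or.inr (Subtype.ext hv)]
  have hde : d * (e * (d + e)) = algebraMap k (Cxy a b) (-(a * b)) :=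
    Subtype.ext (xy_mul_yx_mul_add a b h2)
  obtain ⟨n, p, q, h⟩ := exists_aeval_of_mem_adjoin h2 h3 hde rfl rfl hgen
  let ev : Cxy a b →ₐ[k] FF a b :=
    { toFun := fun c => rep a b h2 h3 ha c 0 0
      map_one' := by simp
      map_zero' := by simp
      map_add' := by simp
      map_mul' := fun u v => by
        have := rep_eq_diagonal a b h2 h3 ha u.2
        change rep a b h2 h3 ha (u * v) 0 0 = _
        rw [map_mul, this, diagonal_mul]
        simp
      commutes' := fun t => by
        change rep a b h2 h3 ha (algebraMap k _ t) 0 0 = _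
        rw [AlgHom.commutes]
        simp [Matrix.algebraMap_matrix_apply] }
  have hd : ev d = dd a b 0 := by
    change rep a b h2 h3 ha (x a b * y a b) 0 0 = _
    rw [rep_xy]; simp
  have he : ev e = dd a b 2 := by
    change rep a b h2 h3 ha (y a b * x a b) 0 0 = _
    rw [rep_yx]; simp
  have hX : ev (9 * (e * (d + e))) = XX a b := by
    rw [← nine_mul_dd a b h2 h3]
    simp only [map_mul, map_add, map_ofNat, hd, he]
  have hY : ev (3 * (e * (9 * (e * (d + e)))) - 27 * algebraMap k _ (a * b / 2)) = YY a b := by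
    rw [map_sub, map_mul ev 3, map_mul ev e, hX, map_mul, AlgHom.commutes, he,
      ← three_mul_dd a b h3]
    simp only [map_ofNat]
  have hev := congrArg ev h
  have hc0 : ev ⟨c, hc⟩ = 0 := h0
  rw [map_mul, hc0, mul_zero, map_add, map_mul ev (Polynomial.aeval _ q), hY,
    ← Polynomial.aeval_algHom_apply, ← Polynomial.aeval_algHom_apply, hX] at hev
  obtain ⟨rfl, rfl⟩ := eq_zero_of_aeval_add a b hev.symm
  rw [map_zero, zero_mul, add_zero] at h
  have hdn : (algebraMap k (Cxy a b) (-(9 * (a * b)))) ^ n * ⟨c, hc⟩ = 0 := by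
    have h9 : algebraMap k (Cxy a b) (-(9 * (a * b))) = d * (9 * (e * (d + e))) := by
      have := congrArg (9 * ·) hde
      simp only [map_neg, map_mul, map_ofNat] at this ⊢
      linear_combination -this
    rw [h9, mul_pow, mul_assoc, h, mul_zero]
  have h9 : -(9 * (a * b)) ≠ 0 := by
    have : (9 : k) = 3 * 3 := by norm_num
    rw [this]
    exact neg_ne_zero.2 (mul_ne_zero (mul_ne_zero h3 h3) (mul_ne_zero ha hb))
  have hu := ((h9.isUnit.map (algebraMap k (Cxy a b))).pow n).mul_right_eq_zero.1 hdn
  exact congrArg Subtype.val hu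

/-- The first row of the matrix of an element of `C + C x + C x²`. -/
theorem rep_add_apply {c₀ c₁ c₂ : Cliff a b} (h₀ : c₀ ∈ Cxy a b) (h₁ : c₁ ∈ Cxy a b)
    (h₂ : c₂ ∈ Cxy a b) : rep a b h2 h3 ha (c₀ + c₁ * x a b + c₂ * x a b ^ 2) 0 =
      ![rep a b h2 h3 ha c₀ 0 0, rep a b h2 h3 ha c₁ 0 0, rep a b h2 h3 ha c₂ 0 0] := by
  rw [map_add, map_add, map_mul, map_mul, map_pow, rep_x, rep_eq_diagonal a b h2 h3 ha h₀,
    rep_eq_diagonal a b h2 h3 ha h₁, rep_eq_diagonal a b h2 h3 ha h₂]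
  ext j
  fin_cases j <;> simp [pow_two, Matrix.mul_apply, Fin.sum_univ_three]

/-- The representation is faithful. -/
theorem rep_injective (hb : b ≠ 0) : Function.Injective (rep a b h2 h3 ha) := by
  rw [injective_iff_map_eq_zero]
  intro v hv
  obtain ⟨c₀, h₀, c₁, h₁, c₂, h₂, rfl⟩ := exists_eq_add a b h2 ha v
  have h := rep_add_apply a b h2 h3 ha h₀ h₁ h₂
  rw [hv] at h
  rw [eq_zero_of_rep_apply_eq_zero a b h2 h3 ha h₀ hb (congrFun h 0).symm,
    eq_zero_of_rep_apply_eq_zero a b h2 h3 ha h₁ hb (congrFun h 1).symm,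
    eq_zero_of_rep_apply_eq_zero a b h2 h3 ha h₂ hb (congrFun h 2).symm]
  simp

/-- `C` is its own centralizer in `A_{f,k}`. -/
theorem mem_Cxy_of_commute (hb : b ≠ 0) {v : Cliff a b} (hv : Commute v (x a b * y a b)) :
    v ∈ Cxy a b := by
  have hd := hv.map (rep a b h2 h3 ha)
  rw [rep_xy] at hd
  have hdiag := eq_diagonal_of_commute (dd_injective a b h2 h3) hd
  obtain ⟨c₀, h₀, c₁, h₁, c₂, h₂, rfl⟩ := exists_eq_add a b h2 ha v
  have h := rep_add_apply a b h2 h3 ha h₀ h₁ h₂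
  rw [hdiag] at h
  rw [eq_zero_of_rep_apply_eq_zero a b h2 h3 ha h₁ hb (congrFun h 1).symm,
    eq_zero_of_rep_apply_eq_zero a b h2 h3 ha h₂ hb (congrFun h 2).symm]
  simpa using h₀

/-- Central elements are represented by scalar matrices. -/
theorem rep_central (hb : b ≠ 0) {c : Cliff a b} (hc : c ∈ Subring.center (Cliff a b)) :
    rep a b h2 h3 ha c = algebraMap (FF a b) _ (rep a b h2 h3 ha c 0 0) := by
  have hC : c ∈ Cxy a b :=
    mem_Cxy_of_commute a b h2 h3 ha hb (Subring.mem_center_iff.1 hc _).symm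
  have hdiag := rep_eq_diagonal a b h2 h3 ha hC
  have hx := congrArg (rep a b h2 h3 ha) (Subring.mem_center_iff.1 hc (x a b))
  rw [map_mul, map_mul, rep_x, hdiag] at hx
  have h01 := congrFun (congrFun hx 0) 1
  have h12 := congrFun (congrFun hx 1) 2
  simp [Matrix.mul_apply, Fin.sum_univ_three] at h01 h12
  rw [hdiag, Matrix.algebraMap_eq_diagonal]
  congr 1
  ext i
  fin_cases i <;> simp [h01, h12]

theorem isUnit_rep_central (hb : b ≠ 0) {c : Cliff a b} (hc : c ∈ Subring.center (Cliff a b))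
    (hc0 : c ≠ 0) : IsUnit (rep a b h2 h3 ha c) := by
  have h := rep_central a b h2 h3 ha hb hc
  have h0 : rep a b h2 h3 ha c 0 0 ≠ 0 := fun h0 => by
    rw [h0, map_zero] at h
    exact hc0 (rep_injective a b h2 h3 ha hb (h.trans (map_zero _).symm))
  rw [h]
  exact h0.isUnit.map _

theorem isDomain_center (hb : b ≠ 0) : IsDomain (Z a b) := by
  have : Nontrivial (Cliff a b) := (rep a b h2 h3 ha).toRingHom.domain_nontrivial
  have : NoZeroDivisors (Z a b) := ⟨fun {c e} h => by
    by_contra! hne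
    have hc := isUnit_rep_central a b h2 h3 ha hb c.2 (by simpa using hne.1)
    have he := isUnit_rep_central a b h2 h3 ha hb e.2 (by simpa using hne.2)
    have h' := congrArg (fun v : Z a b => rep a b h2 h3 ha v) h
    simp at h'
    exact (hc.mul he).ne_zero h'⟩
  exact NoZeroDivisors.to_isDomain _

/-- The representation extends to the ring of central quotients. -/
theorem exists_rep_quot (hb : b ≠ 0) :
    ∃ Θ : Quot a b →ₐ[k] Matrix (Fin 3) (Fin 3) (FF a b), Function.Injective Θ ∧
      ∀ α, Θ (toQuot a b α) = rep a b h2 h3 ha α := by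
  have := isDomain_center a b h2 h3 ha hb
  obtain ⟨G, hG⟩ := CentralQuot.exists_lift (rep a b h2 h3 ha).toRingHom
    (fun c => by
      have h := rep_central a b h2 h3 ha hb c.2
      rw [Subring.mem_center_iff]
      intro N
      change N * rep a b h2 h3 ha c = rep a b h2 h3 ha c * N
      rw [h, Algebra.commutes])
    (fun c hc => isUnit_rep_central a b h2 h3 ha hb c.2 (by
      simpa using nonZeroDivisors.ne_zero hc))
  refine ⟨{ G with commutes' := fun t => ?_ }, ?_, hG⟩
  · change G (algebraMap k (Cliff a b) t ⊗ₜ 1) = _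
    rw [hG]
    exact AlgHom.commutes _ t
  · change Function.Injective G
    rw [injective_iff_map_eq_zero]
    intro v hv
    obtain ⟨α, c, hc, h⟩ := exists_denominator v
    have h' := congrArg G h
    rw [map_mul, hv, zero_mul, hG] at h'
    have hα : α = 0 := rep_injective a b h2 h3 ha hb (h'.symm.trans (map_zero _).symm)
    rw [hα, TensorProduct.zero_tmul] at h
    exact (isUnit_central_tmul_one c hc).mul_left_eq_zero.1 h

end

end Representation

/-! ### The maximal subfield -/

section MaximalSubfields

variable {k : Type*} [Field k] (a b : k)

theorem omega_sq {ω : k} (hω : IsPrimitiveRoot ω 3) : ω ^ 2 = -1 - ω := by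
  have h := hω.geom_sum_eq_zero (by norm_num)
  simp [Finset.sum_range_succ] at h
  linear_combination h

theorem commute_inverse {B : Type*} [Ring B] {g v w : B} (h : Commute g v) (hvw : v * w = 1)
    (hwv : w * v = 1) : Commute g w :=
  Commute.units_inv_right (u := ⟨v, w, hvw, hwv⟩) h

/-- The centralizer of `xy` and `yx` in `B_{f,k}`. It turns out to be the subfield that they
generate, and to be `k(r, s)(u)` if `k` contains `ω`. -/
def Kxy : Subalgebra k (Quot a b) :=
  Subalgebra.centralizer k {toQuot a b (x a b * y a b), toQuot a b (y a b * x a b)}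

variable {a b} in
theorem mem_Kxy {v : Quot a b} : v ∈ Kxy a b ↔ Commute (toQuot a b (x a b * y a b)) v ∧
    Commute (toQuot a b (y a b * x a b)) v := by
  simp [Kxy, Subalgebra.mem_centralizer_iff, commute_iff_eq]

variable {a b} in
theorem inverse_mem_Kxy {v w : Quot a b} (hv : v ∈ Kxy a b) (hvw : v * w = 1) (hwv : w * v = 1) :
    w ∈ Kxy a b :=
  mem_Kxy.2 ⟨commute_inverse (mem_Kxy.1 hv).1 hvw hwv, commute_inverse (mem_Kxy.1 hv).2 hvw hwv⟩

variable (h2 : (2 : k) ≠ 0) (h3 : (3 : k) ≠ 0) (ha : a ≠ 0) (hb : b ≠ 0)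

include h2 in
theorem toQuot_mem_Kxy {c : Cliff a b} (hc : c ∈ Cxy a b) : toQuot a b c ∈ Kxy a b :=
  mem_Kxy.2 ⟨(Cxy_commute a b h2 (xy_mem_Cxy a b) hc).map _,
    (Cxy_commute a b h2 (yx_mem_Cxy a b) hc).map _⟩

include h2 h3 ha hb

theorem toQuot_injective : Function.Injective (toQuot a b) := by
  obtain ⟨Θ, -, h⟩ := exists_rep_quot a b h2 h3 ha hb
  exact Function.Injective.of_comp (f := Θ)
    ((funext h : Θ ∘ toQuot a b = rep a b h2 h3 ha) ▸ rep_injective a b h2 h3 ha hb)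

/-- The elements of the centralizer of `xy` and `yx` are the fractions with numerator in
`k[xy, yx]` and central denominator. -/
theorem exists_mul_eq_of_mem_Kxy {v : Quot a b} (hv : v ∈ Kxy a b) :
    ∃ c ∈ Cxy a b, ∃ e : Z a b, IsUnit (toQuot a b e) ∧ v * toQuot a b e = toQuot a b c := by
  obtain ⟨c, e, he, h⟩ := exists_denominator v
  refine ⟨c, ?_, e, isUnit_central_tmul_one e he, h⟩
  refine mem_Cxy_of_commute a b h2 h3 ha hb (Commute.symm ?_)
  have hcomm : Commute (toQuot a b (x a b * y a b)) (toQuot a b c) := by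
    rw [← (show v * toQuot a b e = toQuot a b c from h)]
    exact (mem_Kxy.1 hv).1.mul_right
      (Subring.mem_center_iff.1 (central_tmul_one_mem_center e) _)
  exact toQuot_injective a b h2 h3 ha hb (by simpa using hcomm.eq)

/-- Evaluation at the generic point of `E'`, extended from `k[xy, yx]` to its fractions. -/
theorem exists_eval : ∃ ev : Kxy a b →ₐ[k] FF a b, Function.Injective ev ∧
    ev ⟨_, toQuot_mem_Kxy a b h2 (xy_mem_Cxy a b)⟩ = dd a b 0 ∧
    ev ⟨_, toQuot_mem_Kxy a b h2 (yx_mem_Cxy a b)⟩ = dd a b 2 := by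
  obtain ⟨Θ, hΘ, h⟩ := exists_rep_quot a b h2 h3 ha hb
  have hdiag : ∀ v ∈ Kxy a b, Θ v = Matrix.diagonal (Θ v).diag := by
    intro v hv
    refine eq_diagonal_of_commute (dd_injective a b h2 h3) ?_
    rw [← rep_xy a b h2 h3 ha, ← h]
    exact (mem_Kxy.1 hv).1.symm.map Θ
  let ev : Kxy a b →ₐ[k] FF a b :=
    { toFun := fun v => Θ v 0 0
      map_one' := by simp
      map_zero' := by simp
      map_add' := by simp
      map_mul' := fun u v => by
        change Θ (u * v) 0 0 = _
        rw [map_mul, hdiag u u.2, Matrix.diagonal_mul]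
        simp
      commutes' := fun t => by
        change Θ (algebraMap k _ t) 0 0 = _
        rw [AlgHom.commutes]
        simp [Matrix.algebraMap_matrix_apply] }
  refine ⟨ev, ?_, ?_, ?_⟩
  · rw [injective_iff_map_eq_zero]
    rintro ⟨v, hv⟩ h0
    have h0' : Θ v 0 0 = 0 := h0
    obtain ⟨c, hc, e, he, hve⟩ := exists_mul_eq_of_mem_Kxy a b h2 h3 ha hb hv
    have hc0 : rep a b h2 h3 ha c 0 0 = 0 := by
      rw [← h, ← hve, map_mul, hdiag v hv, Matrix.diagonal_mul, Matrix.diag_apply, h0', zero_mul]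
    rw [eq_zero_of_rep_apply_eq_zero a b h2 h3 ha hc hb hc0, map_zero] at hve
    exact Subtype.ext (he.mul_left_eq_zero.1 hve)
  · change Θ (toQuot a b (x a b * y a b)) 0 0 = _
    rw [h, rep_xy]; simp
  · change Θ (toQuot a b (y a b * x a b)) 0 0 = _
    rw [h, rep_yx]; simp

theorem Kxy_commute {u v : Quot a b} (hu : u ∈ Kxy a b) (hv : v ∈ Kxy a b) : u * v = v * u := by
  obtain ⟨ev, hev, -⟩ := exists_eval a b h2 h3 ha hb
  have h : (⟨u, hu⟩ * ⟨v, hv⟩ : Kxy a b) = ⟨v, hv⟩ * ⟨u, hu⟩ :=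
    hev (by rw [map_mul, map_mul, mul_comm])
  exact congrArg Subtype.val h

theorem Cxy_mul_ne_zero {c e : Cliff a b} (hc : c ∈ Cxy a b) (he : e ∈ Cxy a b) (hc0 : c ≠ 0)
    (he0 : e ≠ 0) : c * e ≠ 0 := by
  intro h
  have h' := congrArg (fun v => rep a b h2 h3 ha v 0 0) h
  simp only [map_mul, map_zero, Matrix.zero_apply] at h'
  rw [rep_eq_diagonal a b h2 h3 ha hc, Matrix.diagonal_mul] at h'
  exact (mul_eq_zero.1 h').elim (fun h => hc0 (eq_zero_of_rep_apply_eq_zero a b h2 h3 ha hc hb h))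
    (fun h => he0 (eq_zero_of_rep_apply_eq_zero a b h2 h3 ha he hb h))

theorem exists_inverse_of_mem_Kxy {v : Quot a b} (hv : v ∈ Kxy a b) (hv0 : v ≠ 0) :
    ∃ w ∈ Kxy a b, v * w = 1 ∧ w * v = 1 := by
  obtain ⟨c, hc, e, he, hve⟩ := exists_mul_eq_of_mem_Kxy a b h2 h3 ha hb hv
  have hc0 : c ≠ 0 := by
    rintro rfl
    rw [map_zero] at hve
    exact hv0 (he.mul_left_eq_zero.1 hve)
  obtain ⟨c', h', c'', h'', hc', hc'', hN⟩ := exists_norm a b h2 ha hc hc0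
  have := isDomain_center a b h2 h3 ha hb
  have hN0 : c * (c' * c'') ≠ 0 :=
    Cxy_mul_ne_zero a b h2 h3 ha hb hc (mul_mem h' h'') hc0
      (Cxy_mul_ne_zero a b h2 h3 ha hb h' h'' hc' hc'')
  obtain ⟨n, hn⟩ := isUnit_central_tmul_one (⟨_, hN⟩ : Z a b)
    (mem_nonZeroDivisors_of_ne_zero fun h => hN0 (congrArg Subtype.val h))
  have hn' : (n : Quot a b) = toQuot a b c * toQuot a b (c' * c'') :=
    hn.trans (map_mul (toQuot a b) c (c' * c''))
  have hnK : (n : Quot a b) ∈ Kxy a b := by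
    rw [hn']
    exact mul_mem (toQuot_mem_Kxy a b h2 hc) (toQuot_mem_Kxy a b h2 (mul_mem h' h''))
  have heK : toQuot a b e ∈ Kxy a b :=
    have hcen := Subring.mem_center_iff.1 (central_tmul_one_mem_center e)
    mem_Kxy.2 ⟨hcen _, hcen _⟩
  have hw : toQuot a b e * toQuot a b (c' * c'') * (n⁻¹ : (Quot a b)ˣ) ∈ Kxy a b :=
    mul_mem (mul_mem heK (toQuot_mem_Kxy a b h2 (mul_mem h' h'')))
      (inverse_mem_Kxy hnK n.mul_inv n.inv_mul)
  have hvw : v * (toQuot a b e * toQuot a b (c' * c'') * (n⁻¹ : (Quot a b)ˣ)) = 1 := by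
    rw [← mul_assoc, ← mul_assoc, hve, ← hn', n.mul_inv]
  exact ⟨_, hw, hvw, (Kxy_commute a b h2 h3 ha hb hw hv).trans hvw⟩

theorem isMaximalSubfield_Kxy : IsMaximalSubfield (Kxy a b).toSubring := by
  have hcen : Subring.centralizer ((Kxy a b).toSubring : Set (Quot a b)) = (Kxy a b).toSubring := by
    ext v
    rw [Subring.mem_centralizer_iff]
    constructor
    · intro h
      exact mem_Kxy.2 ⟨h _ (toQuot_mem_Kxy a b h2 (xy_mem_Cxy a b)),
        h _ (toQuot_mem_Kxy a b h2 (yx_mem_Cxy a b))⟩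
    · exact fun hv u hu => Kxy_commute a b h2 h3 ha hb hu hv
  have : Nontrivial (Cliff a b) := (rep a b h2 h3 ha).toRingHom.domain_nontrivial
  have : Nontrivial (Quot a b) := (toQuot_injective a b h2 h3 ha hb).nontrivial
  refine ⟨⟨⟨0, 1, zero_ne_one⟩, ?_, ?_⟩, ?_, hcen⟩
  · exact fun u v => Subtype.ext (Kxy_commute a b h2 h3 ha hb u.2 v.2)
  · rintro ⟨v, hv⟩ hv0
    obtain ⟨w, hw, hvw, -⟩ := exists_inverse_of_mem_Kxy a b h2 h3 ha hb hv
      (fun h => hv0 (Subtype.ext h))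
    exact ⟨⟨w, hw⟩, Subtype.ext hvw⟩
  · intro M hM hle
    refine le_antisymm (fun v hv => ?_) hle
    rw [← hcen, Subring.mem_centralizer_iff]
    exact fun u hu => congrArg Subtype.val (hM.mul_comm ⟨u, hle hu⟩ ⟨v, hv⟩)

/-- A subalgebra of the centralizer that contains `xy` and `yx` and is closed under inversion takes
every value at the generic point of `E'`. -/
theorem exists_eval_eq (ev : Kxy a b →ₐ[k] FF a b)
    (hx : ev ⟨_, toQuot_mem_Kxy a b h2 (xy_mem_Cxy a b)⟩ = dd a b 0)
    (hy : ev ⟨_, toQuot_mem_Kxy a b h2 (yx_mem_Cxy a b)⟩ = dd a b 2) {T : Subalgebra k (Quot a b)}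
    (hxT : toQuot a b (x a b * y a b) ∈ T) (hyT : toQuot a b (y a b * x a b) ∈ T)
    (hinv : ∀ v ∈ T, ∀ w, v * w = 1 → w * v = 1 → w ∈ T) (f : FF a b) :
    ∃ v : Kxy a b, (v : Quot a b) ∈ T ∧ ev v = f := by
  suffices h : (T.comap (Kxy a b).val).map ev = ⊤ by
    obtain ⟨v, hv, h⟩ := h.ge (trivial : f ∈ (⊤ : Subalgebra k (FF a b)))
    exact ⟨v, hv, h⟩
  have h0 : dd a b 0 ∈ (T.comap (Kxy a b).val).map ev := ⟨_, hxT, hx⟩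
  have h2' : dd a b 2 ∈ (T.comap (Kxy a b).val).map ev := ⟨_, hyT, hy⟩
  have hX : XX a b ∈ (T.comap (Kxy a b).val).map ev := by
    rw [← nine_mul_dd a b h2 h3]
    exact mul_mem (ofNat_mem _ 9) (mul_mem h2' (add_mem h0 h2'))
  have hY : YY a b ∈ (T.comap (Kxy a b).val).map ev := by
    rw [← three_mul_dd a b h3]
    exact sub_mem (mul_mem (ofNat_mem _ 3) (mul_mem h2' hX))
      (mul_mem (ofNat_mem _ 27) (Subalgebra.algebraMap_mem _ _))
  refine subalgebra_eq_top a b hX hY ?_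
  rintro _ ⟨v, hv, rfl⟩
  by_cases hv0 : v = 0
  · rw [hv0, map_zero, inv_zero]
    exact zero_mem _
  · obtain ⟨w, hw, hvw, hwv⟩ := exists_inverse_of_mem_Kxy a b h2 h3 ha hb v.2
      (fun h => hv0 (Subtype.ext h))
    refine ⟨⟨w, hw⟩, hinv _ hv w hvw hwv, ?_⟩
    have h1 : ev v * ev ⟨w, hw⟩ = 1 := by
      rw [← map_mul, show v * ⟨w, hw⟩ = 1 from Subtype.ext hvw, map_one]
    exact eq_inv_of_mul_eq_one_right h1

theorem nonempty_Kxy_algEquiv : Nonempty (Kxy a b ≃ₐ[k] FF a b) := by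
  obtain ⟨ev, hev, hx, hy⟩ := exists_eval a b h2 h3 ha hb
  refine ⟨AlgEquiv.ofBijective ev ⟨hev, fun f => ?_⟩⟩
  obtain ⟨v, -, h⟩ := exists_eval_eq a b h2 h3 ha hb ev hx hy
    (toQuot_mem_Kxy a b h2 (xy_mem_Cxy a b)) (toQuot_mem_Kxy a b h2 (yx_mem_Cxy a b))
    (fun _ hv _ => inverse_mem_Kxy hv) f
  exact ⟨v, h⟩

/-- The centralizer of `xy` and `yx` is the subfield that they generate. -/
theorem Kxy_le {T : Subalgebra k (Quot a b)} (hxT : toQuot a b (x a b * y a b) ∈ T)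
    (hyT : toQuot a b (y a b * x a b) ∈ T)
    (hinv : ∀ v ∈ T, ∀ w, v * w = 1 → w * v = 1 → w ∈ T) : Kxy a b ≤ T := by
  intro v hv
  obtain ⟨ev, hev, hx, hy⟩ := exists_eval a b h2 h3 ha hb
  obtain ⟨w, hw, h⟩ := exists_eval_eq a b h2 h3 ha hb ev hx hy hxT hyT hinv (ev ⟨v, hv⟩)
  rwa [hev h] at hw

/-- If `k` contains `ω`, then `k(r, s)(u)` is the centralizer of `xy` and `yx`. -/
theorem K_eq_Kxy {ω : k} (hω : IsPrimitiveRoot ω 3) : K a b ω = Kxy a b := by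
  have hω2 := omega_sq hω
  have hd := xy_mem_Cxy a b
  have hd' := yx_mem_Cxy a b
  have hz : z a b ω ∈ Cxy a b := sub_mem hd' (Subalgebra.smul_mem _ hd _)
  have hζ : zeta a b ω ∈ Cxy a b := sub_mem hd' (Subalgebra.smul_mem _ hd _)
  have hu : u a b ω = 2 * (y a b * x a b) + x a b * y a b := by
    rw [u, z, zeta, hω2, two_mul]
    module
  have hr : u a b ω ^ 2 - r a b ω =
      3 * (y a b * x a b * (x a b * y a b + y a b * x a b)) := by
    have hc := (commute_xy_yx a b h2).eq
    rw [hu, r, z, zeta, hω2]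
    generalize x a b * y a b = d at hc
    generalize y a b * x a b = e at hc
    have hω' : ω * (-1 - ω) = 1 := by linear_combination -hω2
    have hprod : (e - ω • d) * (e - (-1 - ω) • d) = e * e + e * d + d * d := by
      simp only [sub_mul, mul_sub, smul_mul_assoc, mul_smul_comm, hc]
      linear_combination (norm := module) hω' • (d * d)
    rw [hprod]
    linear_combination (norm := noncomm_ring) hc + hc
  apply le_antisymm
  · refine sInf_le ⟨?_, fun v hv w => inverse_mem_Kxy hv⟩
    rintro _ (rfl | rfl | rfl)
    · exact toQuot_mem_Kxy a b h2 (mul_mem hz hζ)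
    · exact toQuot_mem_Kxy a b h2
        (Subalgebra.smul_mem _ (add_mem (pow_mem hz 3) (pow_mem hζ 3)) _)
    · exact toQuot_mem_Kxy a b h2 (add_mem hz hζ)
  · refine le_sInf ?_
    rintro T ⟨hT, hinv⟩
    have hrT := hT (Set.mem_insert _ _)
    have huT := hT (Set.mem_insert_of_mem _ (Set.mem_insert_of_mem _ rfl))
    have hvT : toQuot a b (u a b ω ^ 2 - r a b ω) ∈ T := by
      rw [map_sub, map_pow]
      exact sub_mem (pow_mem huT 2) hrT
    -- `u² - r = 3 yx (xy + yx)` inverts `xy` up to the constant `-3ab`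
    have hab : -(3 * (a * b)) ≠ 0 := neg_ne_zero.2 (mul_ne_zero h3 (mul_ne_zero ha hb))
    have hinv₁ : x a b * y a b * (u a b ω ^ 2 - r a b ω) = algebraMap k _ (-(3 * (a * b))) := by
      have h := congrArg (3 * ·) (xy_mul_yx_mul_add a b h2)
      rw [hr]
      simp only [map_neg, map_mul, map_ofNat] at h ⊢
      linear_combination (norm := noncomm_ring) h
    have hinv₂ : (u a b ω ^ 2 - r a b ω) * (x a b * y a b) = algebraMap k _ (-(3 * (a * b))) := by
      rw [← hinv₁]
      exact (Cxy_commute a b h2 (sub_mem (pow_mem (add_mem hz hζ) 2) (mul_mem hz hζ)) hd).eq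
    have hdT : toQuot a b (x a b * y a b) ∈ T := by
      have h := hinv _ hvT (toQuot a b ((-(3 * (a * b)))⁻¹ • (x a b * y a b)))
        (by rw [← map_mul, mul_smul_comm, hinv₂, Algebra.smul_def, ← map_mul,
              inv_mul_cancel₀ hab, map_one, map_one])
        (by rw [← map_mul, smul_mul_assoc, hinv₁, Algebra.smul_def, ← map_mul,
              inv_mul_cancel₀ hab, map_one, map_one])
      rw [map_smul] at h
      have h' := T.smul_mem h (-(3 * (a * b)))
      rwa [smul_smul, mul_inv_cancel₀ hab, one_smul] at h'
    refine Kxy_le a b h2 h3 ha hb hdT ?_ hinv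
    have h := T.smul_mem (sub_mem huT hdT) (2⁻¹ : k)
    rw [← map_sub, hu, add_sub_cancel_right, ← map_smul] at h
    convert h using 2
    rw [← map_ofNat (algebraMap k (Cliff a b)), ← Algebra.smul_def, smul_smul,
      inv_mul_cancel₀ h2, one_smul]

end MaximalSubfields

/-! ### The quadratic extension and base change of the Clifford algebra -/

section Quadratic

variable {L F : Type*} [Field L] [Field F] [Algebra L F] {ω : F}

theorem adjoin_omega_eq_top (hω : IsPrimitiveRoot ω 3)
    (hF : IntermediateField.adjoin L {ω} = ⊤) : Algebra.adjoin L {ω} = ⊤ := by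
  rw [← IntermediateField.adjoin_simple_toSubalgebra_of_isAlgebraic
    (hω.isIntegral (by norm_num)).tower_top.isAlgebraic, hF, IntermediateField.top_toSubalgebra]

theorem exists_eq_add_mul_omega (hω : IsPrimitiveRoot ω 3)
    (hF : IntermediateField.adjoin L {ω} = ⊤) (t : F) :
    ∃ l m : L, t = algebraMap L F l + algebraMap L F m * ω := by
  have ht : t ∈ Algebra.adjoin L {ω} := by rw [adjoin_omega_eq_top hω hF]; trivial
  have hω2 := omega_sq hω
  induction ht using Algebra.adjoin_induction with
  | mem u hu => rcases hu with rfl; exact ⟨0, 1, by simp⟩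
  | algebraMap l => exact ⟨l, 0, by simp⟩
  | add u v _ _ hu hv =>
    obtain ⟨l, m, rfl⟩ := hu
    obtain ⟨l', m', rfl⟩ := hv
    exact ⟨l + l', m + m', by simp only [map_add]; ring⟩
  | mul u v _ _ hu hv =>
    obtain ⟨l, m, rfl⟩ := hu
    obtain ⟨l', m', rfl⟩ := hv
    refine ⟨l * l' - m * m', l * m' + m * l' - m * m', ?_⟩
    simp only [map_add, map_sub, map_mul]
    linear_combination algebraMap L F m * algebraMap L F m' * hω2

/-- The conjugation of `F = L(ω)` over `L`. -/
theorem exists_conj (hω : IsPrimitiveRoot ω 3) (hF : IntermediateField.adjoin L {ω} = ⊤)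
    (hωL : ω ∉ (algebraMap L F).range) : ∃ τ : F →ₐ[L] F, τ ω = ω ^ 2 := by
  have hint : IsIntegral L ω := (hω.isIntegral (by norm_num)).tower_top
  have hω2 := omega_sq hω
  have hmin : minpoly L ω = Polynomial.X ^ 2 + Polynomial.X + 1 := by
    have hdeg : (Polynomial.X ^ 2 + Polynomial.X + 1 : Polynomial L).natDegree = 2 := by
      compute_degree!
    have hmonic : (Polynomial.X ^ 2 + Polynomial.X + 1 : Polynomial L).Monic := by monicity!
    refine (Polynomial.eq_of_monic_of_dvd_of_natDegree_le (minpoly.monic hint) hmonic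
      (minpoly.dvd L ω ?_) ?_).symm
    · simp [hω2]
    · rw [hdeg]
      exact (minpoly.two_le_natDegree_iff hint).2 hωL
  let pb := PowerBasis.ofAdjoinEqTop' hint (adjoin_omega_eq_top hω hF)
  have hgen : pb.gen = ω := PowerBasis.ofAdjoinEqTop'_gen _ _
  refine ⟨pb.lift (ω ^ 2) ?_, ?_⟩
  · rw [hgen, hmin]
    simp only [map_add, map_pow, Polynomial.aeval_X, map_one]
    linear_combination (ω ^ 2 - ω + 1) * hω2
  · exact (congrArg (pb.lift (ω ^ 2) _) hgen.symm).trans (pb.lift_gen _ _)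

end Quadratic

section BaseChange

variable {L : Type*} (F : Type*) [Field L] [Field F] [Algebra L F] (a b : L)

/-- `A_{f,F}` for a form `f = a X³ + b Y³` over `L` and an extension field `F` of `L`. -/
abbrev CliffExt : Type _ := Cliff (algebraMap L F a) (algebraMap L F b)

/-- The canonical map `A_{f,L} → A_{f,F}`. -/
def extend : Cliff a b →ₐ[L] CliffExt F a b :=
  Cliff.lift (x _ _) (y _ _) (fun p q => by
    have h := cube_linear (algebraMap L F a) (algebraMap L F b) (algebraMap L F p)
      (algebraMap L F q)
    rw [algebraMap_smul, algebraMap_smul] at h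
    rw [h, IsScalarTower.algebraMap_apply L F (CliffExt F a b)]
    simp only [map_add, map_mul, map_pow])

theorem extend_x : extend F a b (x a b) = x _ _ := Cliff.lift_x _ _ _

theorem extend_y : extend F a b (y a b) = y _ _ := Cliff.lift_y _ _ _

/-- The converse of `mixed_relations`: four relations suffice for all `p` and `q`. -/
theorem cube_of_mixed {k T : Type*} [Field k] [Ring T] [Algebra k T] {X Y : T} {a b : k}
    (hX : X ^ 3 = algebraMap k T a) (hY : Y ^ 3 = algebraMap k T b)
    (h₁ : X * X * Y + X * Y * X + Y * X * X = 0) (h₂ : X * Y * Y + Y * X * Y + Y * Y * X = 0)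
    (p q : k) : (p • X + q • Y) ^ 3 = algebraMap k T (a * p ^ 3 + b * q ^ 3) := by
  have h : (p • X + q • Y) ^ 3 = p ^ 3 • X ^ 3 + q ^ 3 • Y ^ 3 +
      (p ^ 2 * q) • (X * X * Y + X * Y * X + Y * X * X) +
      (p * q ^ 2) • (X * Y * Y + Y * X * Y + Y * Y * X) := by
    simp only [pow_succ, pow_zero, one_mul, add_mul, mul_add, smul_mul_assoc, mul_smul_comm,
      smul_smul, smul_add, mul_assoc]
    module
  rw [h, h₁, h₂, hX, hY, smul_zero, smul_zero, add_zero, add_zero, Algebra.smul_def,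
    Algebra.smul_def, ← map_mul, ← map_mul, ← map_add]
  congr 1
  ring

variable (h2 : (2 : L) ≠ 0)

/-- The comparison map `A_{f,F} → F ⊗_L A_{f,L}`. -/
def toTensor : CliffExt F a b →ₐ[F] F ⊗[L] Cliff a b :=
  Cliff.lift (1 ⊗ₜ x a b) (1 ⊗ₜ y a b) (by
    obtain ⟨s₁, s₂⟩ := mixed_relations a b h2
    have hmap : ∀ l : L, (1 ⊗ₜ[L] algebraMap L (Cliff a b) l : F ⊗[L] Cliff a b) =
        algebraMap F _ (algebraMap L F l) := by
      intro l
      rw [Algebra.TensorProduct.algebraMap_apply, Algebra.algebraMap_self_apply,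
        Algebra.algebraMap_eq_smul_one, Algebra.algebraMap_eq_smul_one,
        TensorProduct.tmul_smul, TensorProduct.smul_tmul']
    refine cube_of_mixed ?_ ?_ ?_ ?_
    · rw [Algebra.TensorProduct.tmul_pow, x_cube, one_pow, hmap]
    · rw [Algebra.TensorProduct.tmul_pow, y_cube, one_pow, hmap]
    · simp only [Algebra.TensorProduct.tmul_mul_tmul, mul_one, ← TensorProduct.tmul_add, s₁,
        TensorProduct.tmul_zero]
    · simp only [Algebra.TensorProduct.tmul_mul_tmul, mul_one, ← TensorProduct.tmul_add, s₂,
        TensorProduct.tmul_zero])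

theorem toTensor_extend (v : Cliff a b) : toTensor F a b h2 (extend F a b v) = 1 ⊗ₜ v := by
  have h : ((toTensor F a b h2).restrictScalars L).comp (extend F a b) =
      Algebra.TensorProduct.includeRight := by
    refine Cliff.algHom_ext ?_ ?_
    · simp only [AlgHom.comp_apply, extend_x]
      exact Cliff.lift_x _ _ _
    · simp only [AlgHom.comp_apply, extend_y]
      exact Cliff.lift_y _ _ _
  exact DFunLike.congr_fun h v

include h2 in
theorem extend_injective : Function.Injective (extend F a b) := by
  have h : Function.Injective
      (Algebra.TensorProduct.includeRight : Cliff a b →ₐ[L] F ⊗[L] Cliff a b) :=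
    Algebra.TensorProduct.includeRight_injective (algebraMap L F).injective
  refine Function.Injective.of_comp (f := toTensor F a b h2) ?_
  exact (funext (toTensor_extend F a b h2) : toTensor F a b h2 ∘ extend F a b = _) ▸ h

variable {F} {ω : F} (hω : IsPrimitiveRoot ω 3) (hF : IntermediateField.adjoin L {ω} = ⊤)

include hω hF in
/-- `A_{f,F} = A_{f,L} + ω A_{f,L}`. -/
theorem exists_eq_extend_add (v : CliffExt F a b) :
    ∃ p q : Cliff a b, v = extend F a b p + algebraMap F _ ω * extend F a b q := by
  have hω2 := congrArg (algebraMap F (CliffExt F a b)) (omega_sq hω)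
  rw [map_pow, map_sub, map_neg, map_one] at hω2
  induction v using Cliff.induction_left with
  | add u v hu hv =>
    obtain ⟨p, q, rfl⟩ := hu
    obtain ⟨p', q', rfl⟩ := hv
    exact ⟨p + p', q + q', by simp only [map_add, mul_add]; abel⟩
  | one => exact ⟨1, 0, by simp⟩
  | smul t v hv =>
    obtain ⟨p, q, rfl⟩ := hv
    obtain ⟨l, m, rfl⟩ := exists_eq_add_mul_omega hω hF t
    refine ⟨l • p - m • q, m • p + l • q - m • q, ?_⟩
    simp only [map_add, map_sub, map_smul, add_smul, mul_smul, algebraMap_smul]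
    have hs : ∀ v : CliffExt F a b, ω • v = algebraMap F _ ω * v := fun v => Algebra.smul_def _ _
    simp only [hs, mul_add, mul_sub, mul_smul_comm, ← mul_assoc, ← sq, hω2, smul_add]
    simp only [sub_mul, neg_mul, one_mul, smul_sub, smul_neg]
    abel
  | mul_x v hv =>
    obtain ⟨p, q, rfl⟩ := hv
    refine ⟨x a b * p, x a b * q, ?_⟩
    rw [map_mul, map_mul, extend_x, mul_add, ← mul_assoc _ (algebraMap F _ ω),
      ← Algebra.commutes ω (x _ _), mul_assoc]
  | mul_y v hv =>
    obtain ⟨p, q, rfl⟩ := hv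
    refine ⟨y a b * p, y a b * q, ?_⟩
    rw [map_mul, map_mul, extend_y, mul_add, ← mul_assoc _ (algebraMap F _ ω),
      ← Algebra.commutes ω (y _ _), mul_assoc]

include h2 hω hF in
/-- The automorphism of `A_{f,F} ≅ F ⊗_L A_{f,L}` induced by the conjugation of `F` over `L`. -/
theorem exists_conj_cliff (hωL : ω ∉ (algebraMap L F).range) :
    ∃ s : CliffExt F a b →ₐ[L] CliffExt F a b,
      s (algebraMap F _ ω) = algebraMap F _ (ω ^ 2) ∧
      ∀ v, s (extend F a b v) = extend F a b v := by
  obtain ⟨τ, hτ⟩ := exists_conj hω hF hωL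
  let g : F ⊗[L] Cliff a b →ₐ[F] CliffExt F a b :=
    Algebra.TensorProduct.lift (Algebra.ofId F _) (extend F a b)
      (fun t v => Algebra.commutes t _)
  have hg : ∀ t v, g (t ⊗ₜ v) = algebraMap F _ t * extend F a b v := fun t v =>
    Algebra.TensorProduct.lift_tmul _ _ _ t v
  refine ⟨((g.restrictScalars L).comp (Algebra.TensorProduct.map τ (AlgHom.id L _))).comp
    ((toTensor F a b h2).restrictScalars L), ?_, fun v => ?_⟩
  · simp only [AlgHom.comp_apply, AlgHom.restrictScalars_apply, AlgHom.commutes]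
    rw [Algebra.TensorProduct.algebraMap_apply, Algebra.algebraMap_self_apply,
      Algebra.TensorProduct.map_tmul, hτ, hg, map_one, map_one, mul_one]
  · simp only [AlgHom.comp_apply, AlgHom.restrictScalars_apply, toTensor_extend]
    rw [Algebra.TensorProduct.map_tmul, hg, map_one, map_one, one_mul, AlgHom.id_apply]

end BaseChange

/-! ### Descent of the ring of central quotients -/

section Abstract

variable {F A B : Type*} [CommRing F] [Ring A] [Ring B]

theorem map_add_algebraMap_mul {L : Type*} [CommRing L] [Algebra F A] [Algebra F B] [Algebra L B]
    (j : A →ₐ[F] B) (σ : B ≃ₐ[L] B) {p q : A} {t t' : F} (hp : σ (j p) = j p) (hq : σ (j q) = j q)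
    (ht : σ (algebraMap F B t) = algebraMap F B t') :
    σ (j (p + algebraMap F A t * q)) = j (p + algebraMap F A t' * q) := by
  simp only [map_add, map_mul, AlgHom.commutes, hp, hq, ht]

theorem mul_map_mul [Algebra F A] [Algebra F B] (j : A →ₐ[F] B) {v : B} {c α : A}
    (h : v * j c = j α) (e : A) : v * j (c * e) = j (α * e) := by
  rw [map_mul, map_mul, ← mul_assoc, h]

theorem map_eq_of_mul_eq [Algebra F B] (σ : B ≃ₐ[F] B) {v n m : B} (hv : σ v = v)
    (hn : σ n = n) (h : v * n = m) : σ m = m := by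
  rw [← h, map_mul, hv, hn]

theorem mem_range_of_mul_map_unit [Algebra F A] [Algebra F B] (ι : A →ₐ[F] B) (n : Aˣ) {v : B}
    {p : A} (h : v * ι n = ι p) : v ∈ ι.range := by
  refine ⟨p * (n⁻¹ : Aˣ), ?_⟩
  change ι _ = v
  rw [map_mul, ← h, mul_assoc, ← map_mul, n.mul_inv, map_one, mul_one]

theorem eq_zero_of_isUnit_map_of_mul_eq_zero [Algebra F A] [Algebra F B] (j : A →ₐ[F] B)
    (hj : Function.Injective j) {c e : A} (hc : IsUnit (j c)) (h : c * e = 0) : e = 0 := by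
  refine hj ?_
  rw [map_zero, ← hc.mul_right_eq_zero, ← map_mul, h, map_zero]

theorem commute_map_iff [Algebra F A] [Algebra F B] {ι : A →ₐ[F] B}
    (hι : Function.Injective ι) {u v : A} : Commute (ι u) (ι v) ↔ Commute u v := by
  rw [commute_iff_eq, commute_iff_eq, ← map_mul, ← map_mul, hι.eq_iff]

end Abstract

section Descent

variable {L F : Type*} [Field L] [Field F] [Algebra L F] (h2 : (2 : L) ≠ 0) (h3 : (3 : L) ≠ 0)
  {ω : F} (hω : IsPrimitiveRoot ω 3) (hF : IntermediateField.adjoin L {ω} = ⊤)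
  (a b : L) (ha : a ≠ 0) (hb : b ≠ 0)

variable (F) in
/-- The canonical map `A_{f,F} → B_{f,F}` for a form over `L`. -/
abbrev toQuotExt : CliffExt F a b →ₐ[F] QuotExt F a b :=
  toQuot (algebraMap L F a) (algebraMap L F b)

theorem IsCanonical.apply_extend {ι : Quot a b →ₐ[L] QuotExt F a b} (hι : IsCanonical F a b ι)
    (v : Cliff a b) : ι (toQuot a b v) = toQuotExt F a b (extend F a b v) := by
  have h : ι.comp (toQuot a b) = ((toQuotExt F a b).restrictScalars L).comp (extend F a b) :=
    Cliff.algHom_ext (hι.1.trans (congrArg (toQuotExt F a b) (extend_x F a b).symm))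
      (hι.2.trans (congrArg (toQuotExt F a b) (extend_y F a b).symm))
  exact DFunLike.congr_fun h v

theorem IsConj.apply_extend {σ : QuotExt F a b ≃ₐ[L] QuotExt F a b} (hσ : IsConj F a b ω σ)
    (v : Cliff a b) : σ (toQuotExt F a b (extend F a b v)) = toQuotExt F a b (extend F a b v) := by
  have h : (σ : QuotExt F a b →ₐ[L] QuotExt F a b).comp
      (((toQuotExt F a b).restrictScalars L).comp (extend F a b)) =
      ((toQuotExt F a b).restrictScalars L).comp (extend F a b) := by
    refine Cliff.algHom_ext ?_ ?_
    · change σ (toQuotExt F a b (extend F a b _)) = toQuotExt F a b (extend F a b _)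
      rw [extend_x]
      exact hσ.2.1
    · change σ (toQuotExt F a b (extend F a b _)) = toQuotExt F a b (extend F a b _)
      rw [extend_y]
      exact hσ.2.2
  exact DFunLike.congr_fun h v

theorem IsConj.apply_extend_add {σ : QuotExt F a b ≃ₐ[L] QuotExt F a b} (hσ : IsConj F a b ω σ)
    (p q : Cliff a b) :
    σ (toQuotExt F a b (extend F a b p + algebraMap F _ ω * extend F a b q)) =
      toQuotExt F a b (extend F a b p + algebraMap F _ (ω ^ 2) * extend F a b q) :=
  map_add_algebraMap_mul (toQuotExt F a b) σ (hσ.apply_extend a b p)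
    (hσ.apply_extend a b q) hσ.1

include hω hF in
theorem IsConj.unique {σ σ' : QuotExt F a b ≃ₐ[L] QuotExt F a b} (hσ : IsConj F a b ω σ)
    (hσ' : IsConj F a b ω σ') : σ = σ' := by
  have h : (σ : QuotExt F a b →+* QuotExt F a b) = σ' := by
    refine CentralQuot.ringHom_ext fun v => ?_
    obtain ⟨p, q, rfl⟩ := exists_eq_extend_add a b hω hF v
    exact (hσ.apply_extend_add a b p q).trans (hσ'.apply_extend_add a b p q).symm
  exact AlgEquiv.ext fun v => DFunLike.congr_fun h v

theorem IsCanonical.unique {ι ι' : Quot a b →ₐ[L] QuotExt F a b} (hι : IsCanonical F a b ι)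
    (hι' : IsCanonical F a b ι') : ι = ι' := by
  have h : (ι : Quot a b →+* QuotExt F a b) = ι' :=
    CentralQuot.ringHom_ext fun v => (hι.apply_extend a b v).trans (hι'.apply_extend a b v).symm
  exact AlgHom.ext fun v => DFunLike.congr_fun h v

include hω hF in
theorem extend_mem_center {c : Cliff a b} (hc : c ∈ Subring.center (Cliff a b)) :
    extend F a b c ∈ Subring.center (CliffExt F a b) := by
  rw [Subring.mem_center_iff] at hc ⊢
  intro v
  obtain ⟨p, q, rfl⟩ := exists_eq_extend_add a b hω hF v
  rw [add_mul, mul_add, mul_assoc, ← map_mul, ← map_mul, ← mul_assoc _ (algebraMap F _ ω),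
    ← Algebra.commutes ω (extend F a b c), mul_assoc, ← map_mul, ← map_mul, hc, hc]

include h2 hω hF in
/-- The sum `A_{f,F} = A_{f,L} + ω A_{f,L}` is direct. -/
theorem eq_zero_of_extend_add_eq_zero (hωL : ω ∉ (algebraMap L F).range) {p q : Cliff a b}
    (h : extend F a b p + algebraMap F _ ω * extend F a b q = 0) : p = 0 ∧ q = 0 := by
  obtain ⟨s, hsω, hs⟩ := exists_conj_cliff a b h2 hω hF hωL
  have h' := congrArg s h
  rw [map_add, map_mul, hs, hs, hsω, map_zero] at h'
  have hne : ω - ω ^ 2 ≠ 0 := by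
    intro h0
    have h1 : ω = 1 := by
      have hω0 := hω.ne_zero (by norm_num)
      have : ω * (1 - ω) = 0 := by linear_combination h0
      exact (sub_eq_zero.1 ((mul_eq_zero.1 this).resolve_left hω0)).symm
    exact hω.ne_one (by norm_num) h1
  have hq : algebraMap F (CliffExt F a b) (ω - ω ^ 2) * extend F a b q = 0 := by
    rw [map_sub, sub_mul, ← sub_eq_zero.2 (h.trans h'.symm)]
    abel
  have hq0 : q = 0 := extend_injective F a b h2
    (((hne.isUnit.map (algebraMap F (CliffExt F a b))).mul_right_eq_zero.1 hq).trans
      (map_zero _).symm)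
  rw [hq0, map_zero, mul_zero, add_zero] at h
  exact ⟨extend_injective F a b h2 (h.trans (map_zero _).symm), hq0⟩

include h2 hω hF in
/-- Both components of a central element of `A_{f,F}` are central in `A_{f,L}`. -/
theorem commute_of_extend_add_mem_center (hωL : ω ∉ (algebraMap L F).range) {p q : Cliff a b}
    (h : extend F a b p + algebraMap F _ ω * extend F a b q ∈ Subring.center (CliffExt F a b))
    (t : Cliff a b) : t * p = p * t ∧ t * q = q * t := by
  have ht := Subring.mem_center_iff.1 h (extend F a b t)
  have hcm := Algebra.commutes ω (extend F a b t)
  have h0 : extend F a b (t * p - p * t) + algebraMap F _ ω * extend F a b (t * q - q * t) = 0 := by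
    simp only [map_sub, map_mul]
    linear_combination (norm := noncomm_ring) ht + hcm * extend F a b q
  obtain ⟨h₁, h₂⟩ := eq_zero_of_extend_add_eq_zero h2 hω hF a b hωL h0
  exact ⟨sub_eq_zero.1 h₁, sub_eq_zero.1 h₂⟩

include hω in
/-- The norm from `A_{f,F}` to `A_{f,L}` of an element with commuting components. -/
theorem extend_add_mul_conj {p q : Cliff a b} (hqp : q * p = p * q) :
    (extend F a b p + algebraMap F _ ω * extend F a b q) *
      (extend F a b p + algebraMap F _ (ω ^ 2) * extend F a b q) =
    extend F a b (p * p - p * q + q * q) := by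
  have hω2 := congrArg (algebraMap F (CliffExt F a b)) (omega_sq hω)
  rw [map_sub, map_neg, map_one] at hω2
  have hω1 : algebraMap F (CliffExt F a b) ω * algebraMap F (CliffExt F a b) (ω ^ 2) = 1 := by
    rw [← map_mul, ← pow_succ', hω.pow_eq_one, map_one]
  have hc₁ := Algebra.commutes (ω ^ 2) (extend F a b p)
  have hc₂ := Algebra.commutes (ω ^ 2) (extend F a b q)
  have hqp' : extend F a b q * extend F a b p = extend F a b p * extend F a b q := by
    rw [← map_mul, ← map_mul, hqp]
  simp only [map_add, map_sub, map_mul]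
  rw [hω2] at hc₁ hc₂ hω1 ⊢
  linear_combination (norm := noncomm_ring) (-1 : ℤ) • (hc₁ * extend F a b q)
    - algebraMap F _ ω * hc₂ * extend F a b q + algebraMap F _ ω * hqp'
    + hω1 * (extend F a b q * extend F a b q)

section

variable (hF2 : (2 : F) ≠ 0) (hF3 : (3 : F) ≠ 0) (haF : algebraMap L F a ≠ 0)
  (hbF : algebraMap L F b ≠ 0)

include h2 h3 hω hF ha hb hF2 hF3 haF hbF

theorem exists_isCanonical : ∃ ι, IsCanonical F a b ι := by
  have := isDomain_center a b h2 h3 ha hb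
  have := isDomain_center (algebraMap L F a) (algebraMap L F b) hF2 hF3 haF hbF
  obtain ⟨G, hG⟩ := CentralQuot.exists_lift
    ((toQuotExt F a b).toRingHom.comp (extend F a b).toRingHom)
    (fun c => central_tmul_one_mem_center
      (⟨_, extend_mem_center hω hF a b c.2⟩ : Subring.center (CliffExt F a b)))
    (fun c hc => isUnit_central_tmul_one
      (⟨_, extend_mem_center hω hF a b c.2⟩ : Subring.center (CliffExt F a b))
      (mem_nonZeroDivisors_of_ne_zero fun h => nonZeroDivisors.ne_zero hc (Subtype.ext
        (extend_injective F a b h2 ((congrArg Subtype.val h).trans (map_zero _).symm)))))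
  refine ⟨{ G with commutes' := fun t => ?_ }, ?_, ?_⟩
  · change G (algebraMap L (Cliff a b) t ⊗ₜ 1) = _
    rw [hG]
    change toQuotExt F a b (extend F a b (algebraMap L _ t)) = _
    rw [AlgHom.commutes]
    rfl
  · exact (hG _).trans (congrArg (toQuotExt F a b) (extend_x F a b))
  · exact (hG _).trans (congrArg (toQuotExt F a b) (extend_y F a b))

omit h3 ha hb in
theorem exists_isConj (hωL : ω ∉ (algebraMap L F).range) : ∃ σ, IsConj F a b ω σ := by
  have := isDomain_center (algebraMap L F a) (algebraMap L F b) hF2 hF3 haF hbF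
  obtain ⟨s, hsω, hs⟩ := exists_conj_cliff a b h2 hω hF hωL
  have hss : ∀ v, s (s v) = v := by
    intro v
    obtain ⟨p, q, rfl⟩ := exists_eq_extend_add a b hω hF v
    simp only [map_add, map_mul, hs, hsω, map_pow]
    rw [← map_pow, ← map_pow, ← pow_mul, show ω ^ (2 * 2) = ω from by
      rw [show 2 * 2 = 3 + 1 from rfl, pow_succ, hω.pow_eq_one, one_mul]]
  have hcen : ∀ c : Subring.center (CliffExt F a b), s c ∈ Subring.center (CliffExt F a b) := by
    intro c
    rw [Subring.mem_center_iff]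
    intro v
    rw [← hss v, ← map_mul, ← map_mul, Subring.mem_center_iff.1 c.2]
  obtain ⟨G, hG⟩ := CentralQuot.exists_lift
    ((toQuotExt F a b).toRingHom.comp s.toRingHom)
    (fun c => central_tmul_one_mem_center
      (⟨_, hcen c⟩ : Subring.center (CliffExt F a b)))
    (fun c hc => isUnit_central_tmul_one
      (⟨_, hcen c⟩ : Subring.center (CliffExt F a b))
      (mem_nonZeroDivisors_of_ne_zero fun h => nonZeroDivisors.ne_zero hc (Subtype.ext
        ((Function.LeftInverse.injective hss)
          ((congrArg Subtype.val h).trans (map_zero s).symm)))))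
  let G' : QuotExt F a b →ₐ[L] QuotExt F a b :=
    { G with
      commutes' := fun t => by
        change G (algebraMap L (CliffExt F a b) t ⊗ₜ 1) = _
        rw [hG]
        change toQuotExt F a b (s (algebraMap L _ t)) = _
        rw [AlgHom.commutes]
        rfl }
  have hGG : G.comp G = RingHom.id _ := by
    refine CentralQuot.ringHom_ext fun v => ?_
    rw [RingHom.comp_apply, hG]
    exact (hG _).trans (congrArg (toQuotExt F a b) (hss v))
  have hGG' : G'.comp G' = AlgHom.id L _ := AlgHom.ext fun v => DFunLike.congr_fun hGG v
  refine ⟨AlgEquiv.ofAlgHom G' G' hGG' hGG', ?_, ?_, ?_⟩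
  · exact (hG _).trans (congrArg (toQuotExt F a b) hsω)
  · rw [← extend_x]
    exact (hG _).trans (congrArg (toQuotExt F a b) (hs _))
  · rw [← extend_y]
    exact (hG _).trans (congrArg (toQuotExt F a b) (hs _))

omit h3 hω hF ha hb in
theorem IsCanonical.injective {ι : Quot a b →ₐ[L] QuotExt F a b} (hι : IsCanonical F a b ι) :
    Function.Injective ι := by
  rw [injective_iff_map_eq_zero]
  intro v hv
  obtain ⟨α, c, hc, h⟩ := exists_denominator v
  have h' : v * toQuot a b c = toQuot a b α := h
  have h0 := congrArg ι h'
  rw [map_mul, hv, zero_mul, hι.apply_extend] at h0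
  have hα : α = 0 := by
    refine extend_injective F a b h2 (toQuot_injective _ _ hF2 hF3 haF hbF (h0.symm.trans ?_))
    rw [map_zero (extend F a b), map_zero (toQuotExt F a b)]
  rw [hα, map_zero] at h'
  exact (isUnit_central_tmul_one c hc).mul_left_eq_zero.1 h'

omit h3 ha hb in
/-- Multiplying a denominator by its conjugate makes it an element of `A_{f,L}`. -/
theorem exists_extend_denominator (hωL : ω ∉ (algebraMap L F).range) (v : QuotExt F a b) :
    ∃ n ∈ Subring.center (Cliff a b), n ≠ 0 ∧ ∃ p q : Cliff a b,
      v * toQuotExt F a b (extend F a b n) =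
        toQuotExt F a b (extend F a b p + algebraMap F _ ω * extend F a b q) := by
  have := isDomain_center (algebraMap L F a) (algebraMap L F b) hF2 hF3 haF hbF
  have hω2 := congrArg (algebraMap F (CliffExt F a b)) (omega_sq hω)
  rw [map_sub, map_neg, map_one] at hω2
  obtain ⟨α, c, hc, h⟩ := exists_denominator v
  have h : v * toQuotExt F a b (c : CliffExt F a b) = toQuotExt F a b α := h
  obtain ⟨p, q, hpq⟩ := exists_eq_extend_add a b hω hF (c : CliffExt F a b)
  have hpqc := commute_of_extend_add_mem_center h2 hω hF a b hωL (hpq ▸ c.2)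
  have hn : p * p - p * q + q * q ∈ Subring.center (Cliff a b) := by
    have hp : p ∈ Subring.center (Cliff a b) := Subring.mem_center_iff.2 fun t => (hpqc t).1
    have hq : q ∈ Subring.center (Cliff a b) := Subring.mem_center_iff.2 fun t => (hpqc t).2
    exact add_mem (sub_mem (mul_mem hp hp) (mul_mem hp hq)) (mul_mem hq hq)
  have hnorm := extend_add_mul_conj hω a b (hpqc q).1
  rw [← hpq] at hnorm
  obtain ⟨p', q', hpq'⟩ := exists_eq_extend_add a b hω hF
    (α * (extend F a b p + algebraMap F _ (ω ^ 2) * extend F a b q))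
  have hv' := mul_map_mul (toQuotExt F a b) h
    (extend F a b p + algebraMap F _ (ω ^ 2) * extend F a b q)
  rw [hnorm, hpq'] at hv'
  refine ⟨_, hn, fun h0 => ?_, p', q', hv'⟩
  rw [h0, map_zero] at hnorm
  have hconj := eq_zero_of_isUnit_map_of_mul_eq_zero (toQuotExt F a b)
    (toQuot_injective _ _ hF2 hF3 haF hbF) (isUnit_central_tmul_one c hc) hnorm
  have hpq0 : extend F a b (p - q) + algebraMap F _ ω * extend F a b (-q) = 0 := by
    rw [hω2] at hconj
    rw [map_sub, map_neg, ← hconj]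
    noncomm_ring
  obtain ⟨h₁, h₂⟩ := eq_zero_of_extend_add_eq_zero h2 hω hF a b hωL hpq0
  have hq0 : q = 0 := neg_eq_zero.1 h₂
  have hp0 : p = 0 := by rw [← sub_eq_zero.1 h₁] at hq0; exact hq0
  rw [hp0, hq0, map_zero, mul_zero, add_zero] at hpq
  exact nonZeroDivisors.ne_zero hc (Subtype.ext hpq)

omit h2 h3 hω hF ha hb in
/-- The numerator of a fixed fraction with denominator in `A_{f,L}` is fixed. -/
theorem IsConj.extend_add_eq {σ : QuotExt F a b ≃ₐ[L] QuotExt F a b} (hσ : IsConj F a b ω σ)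
    {v : QuotExt F a b} (hv : σ v = v) {n p q : Cliff a b}
    (h : v * toQuotExt F a b (extend F a b n) =
      toQuotExt F a b (extend F a b p + algebraMap F _ ω * extend F a b q)) :
    extend F a b p + algebraMap F _ ω * extend F a b q =
      extend F a b p + algebraMap F _ (ω ^ 2) * extend F a b q := by
  have h₁ := map_eq_of_mul_eq σ hv (hσ.apply_extend a b n) h
  have h₂ := hσ.apply_extend_add a b p q
  exact toQuot_injective _ _ hF2 hF3 haF hbF (h₁.symm.trans h₂)

/-- The fixed ring of the conjugation is `B_{f,L}`: a fixed fraction with denominator in `A_{f,L}`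
has its numerator in `A_{f,L}`, too. -/
theorem IsCanonical.range_eq_fixed (hωL : ω ∉ (algebraMap L F).range)
    {σ : QuotExt F a b ≃ₐ[L] QuotExt F a b} {ι : Quot a b →ₐ[L] QuotExt F a b}
    (hσ : IsConj F a b ω σ) (hι : IsCanonical F a b ι) : ι.range = fixed σ := by
  apply le_antisymm
  · rintro _ ⟨v, rfl⟩
    have h : (σ : QuotExt F a b →ₐ[L] QuotExt F a b).comp ι = ι := by
      refine IsCanonical.unique a b ⟨?_, ?_⟩ hι
      · exact (congrArg σ hι.1).trans hσ.2.1
      · exact (congrArg σ hι.2).trans hσ.2.2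
    exact DFunLike.congr_fun h v
  · intro v hv
    obtain ⟨m, hm, hm0, p, q, h⟩ := exists_extend_denominator h2 hω hF a b hF2 hF3 haF hbF hωL v
    have hpq := hσ.extend_add_eq a b hF2 hF3 haF hbF hv h
    have hq : q = 0 := by
      have hω2 := congrArg (algebraMap F (CliffExt F a b)) (omega_sq hω)
      rw [map_sub, map_neg, map_one] at hω2
      -- `ω² = -1 - ω` turns `ω q = ω² q` into `q + 2 ω q = 0`
      refine (eq_zero_of_extend_add_eq_zero h2 hω hF a b hωL (p := q) (q := 2 * q) ?_).1
      rw [hω2] at hpq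
      rw [map_mul, map_ofNat]
      linear_combination (norm := noncomm_ring) hpq
    rw [hq, map_zero (extend F a b), mul_zero, add_zero] at h
    have := isDomain_center a b h2 h3 ha hb
    obtain ⟨n, hn⟩ := isUnit_central_tmul_one (⟨m, hm⟩ : Z a b)
      (mem_nonZeroDivisors_of_ne_zero fun h => hm0 (congrArg Subtype.val h))
    have hn : (n : Quot a b) = toQuot a b m := hn
    refine mem_range_of_mul_map_unit ι n (p := toQuot a b p) ?_
    rw [hn]
    exact (congrArg (v * ·) (hι.apply_extend a b m)).trans
      (Eq.trans h (hι.apply_extend a b p).symm)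

end

/-- The subfields generated by `xy` and `yx` over `L` and over `F` correspond: both are
centralizers of `xy` and `yx`. -/
theorem map_Kxy {ι : Quot a b →ₐ[L] QuotExt F a b} (hinj : Function.Injective ι)
    (hι : IsCanonical F a b ι) : (Kxy a b).map ι =
      (Kxy (algebraMap L F a) (algebraMap L F b)).restrictScalars L ⊓ ι.range := by
  have hxy : ι (toQuot a b (x a b * y a b)) = toQuotExt F a b (x _ _ * y _ _) := by
    rw [hι.apply_extend, map_mul (extend F a b), extend_x, extend_y]
  have hyx : ι (toQuot a b (y a b * x a b)) = toQuotExt F a b (y _ _ * x _ _) := by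
    rw [hι.apply_extend, map_mul (extend F a b), extend_x, extend_y]
  have key : ∀ v, v ∈ Kxy a b ↔ ι v ∈ Kxy (algebraMap L F a) (algebraMap L F b) := by
    intro v
    rw [mem_Kxy, mem_Kxy, ← hxy, ← hyx]
    exact and_congr (commute_map_iff hinj).symm (commute_map_iff hinj).symm
  ext w
  constructor
  · rintro ⟨v, hv, rfl⟩
    exact ⟨(key v).1 hv, v, rfl⟩
  · rintro ⟨hw, v, rfl⟩
    exact ⟨v, (key v).2 hw, rfl⟩

end Descent

end CubicClifford

end

theorem proposition7p3
    {L F : Type*} [Field L] [Infinite L] [Field F] [Algebra L F]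
    (h2 : (2 : L) ≠ 0) (h3 : (3 : L) ≠ 0)
    (ω : F) (hω : IsPrimitiveRoot ω 3) (hF : IntermediateField.adjoin L {ω} = ⊤)
    (a b : L) (ha : a ≠ 0) (hb : b ≠ 0) :
    -- `K = F(r, s)(u)` is a maximal subfield of `B_{f,F}`, isomorphic to `F(E')` over `F`
    (CubicClifford.IsMaximalSubfield
        (CubicClifford.K (algebraMap L F a) (algebraMap L F b) ω).toSubring ∧
      Nonempty (CubicClifford.K (algebraMap L F a) (algebraMap L F b) ω ≃ₐ[F]
        (CubicClifford.E' (algebraMap L F a) (algebraMap L F b)).FunctionField)) ∧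
    (ω ∉ (algebraMap L F).range →
      -- `σ` on `B_{f,F}` and the map `ι : B_{f,L} → B_{f,F}` exist and are unique
      (∃! σ, CubicClifford.IsConj F a b ω σ) ∧
      (∃! ι, CubicClifford.IsCanonical F a b ι) ∧
      ∀ σ ι, CubicClifford.IsConj F a b ω σ → CubicClifford.IsCanonical F a b ι →
        -- `ι` identifies `B_{f,L}` with the fixed ring of `σ`
        Function.Injective ι ∧ ι.range = CubicClifford.fixed σ ∧
        -- the fixed field `K^σ`, viewed in `B_{f,L}`
        ∃ M : Subalgebra L (CubicClifford.Quot a b),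
          M.map ι = (CubicClifford.K (algebraMap L F a) (algebraMap L F b) ω).restrictScalars L ⊓
            CubicClifford.fixed σ ∧
          CubicClifford.IsMaximalSubfield M.toSubring ∧
          Nonempty (M ≃ₐ[L] (CubicClifford.E' a b).FunctionField)) := by
  have hF2 : (2 : F) ≠ 0 := by
    rw [← map_ofNat (algebraMap L F) 2]; exact (map_ne_zero _).2 h2
  have hF3 : (3 : F) ≠ 0 := by
    rw [← map_ofNat (algebraMap L F) 3]; exact (map_ne_zero _).2 h3
  have haF : algebraMap L F a ≠ 0 := (map_ne_zero _).2 ha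
  have hbF : algebraMap L F b ≠ 0 := (map_ne_zero _).2 hb
  rw [CubicClifford.K_eq_Kxy _ _ hF2 hF3 haF hbF hω]
  refine ⟨⟨CubicClifford.isMaximalSubfield_Kxy _ _ hF2 hF3 haF hbF,
    CubicClifford.nonempty_Kxy_algEquiv _ _ hF2 hF3 haF hbF⟩, fun hωL => ⟨?_, ?_, ?_⟩⟩
  · obtain ⟨σ, hσ⟩ := CubicClifford.exists_isConj h2 hω hF a b hF2 hF3 haF hbF hωL
    exact ⟨σ, hσ, fun σ' hσ' => CubicClifford.IsConj.unique hω hF a b hσ' hσ⟩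
  · obtain ⟨ι, hι⟩ := CubicClifford.exists_isCanonical h2 h3 hω hF a b ha hb hF2 hF3 haF hbF
    exact ⟨ι, hι, fun ι' hι' => CubicClifford.IsCanonical.unique a b hι' hι⟩
  · intro σ ι hσ hι
    have hιinj := CubicClifford.IsCanonical.injective h2 a b hF2 hF3 haF hbF hι
    have hrange := CubicClifford.IsCanonical.range_eq_fixed h2 h3 hω hF a b ha hb hF2 hF3 haF hbF
      hωL hσ hι
    refine ⟨hιinj, hrange, CubicClifford.Kxy a b, ?_,
      CubicClifford.isMaximalSubfield_Kxy a b h2 h3 ha hb,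
      CubicClifford.nonempty_Kxy_algEquiv a b h2 h3 ha hb⟩
    rw [← hrange]
    exact CubicClifford.map_Kxy a b hιinj hι
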